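/- **Conventions.** A *Frölicher space* is a set $X$ with a set of curves $\mathbb{R}\to X$ and a set of functions $X\to\mathbb{R}$, such that $c$ is a curve iff $f\circ c$ is smooth for every function $f$, and $f$ is a function iff $f\circ c$ is smooth for every curve $c$; smooth maps are the maps that preserve curves. $\mathbf{FS}$ is the category of Frölicher spaces and $X^Y=C^\infty(Y,X)$ is its exponential. A *Weil algebra* is $W=C^\infty(\mathbb{R}^k)/I$, where the ideal $I$ lies in $\mathfrak{m}_0=\{u : u(0)=0\}$ and contains a power of $\mathfrak{m}_0$. $\otimes_\infty$ is the coproduct of $C^\infty$-rings, $C^\infty(\mathbb{R}^a)/I\otimes_\infty C^\infty(\mathbb{R}^b)/J=C^\infty(\mathbb{R}^{a+b})/(I,J)$. The *Weil prolongation* $X\otimes W$ is the set of classes $[f]$ of smooth maps $f:\mathbb{R}^k\to X$, where $f\equiv g$ iff $f(0)=g(0)$ and $\chi\circ f-\chi\circ g\in I$ for all $\chi\in C^\infty(X,\mathbb{R})$, with the initial Frölicher structure for the maps $\chi\otimes W:X\otimes W\to\mathbb{R}\otimes W$, $[f]\mapsto[\chi\circ f]$; here $\mathbb{R}\otimes W=W$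 has its structure as a finite-dimensional vector space. $X$ is *Weil-exponentiable* if for all Frölicher spaces $Y$ and Weil algebras $W_1=C^\infty(\mathbb{R}^a)/I_1$, $W_2=C^\infty(\mathbb{R}^b)/I_2$ one has canonically $(X\otimes W_1)^Y\otimes W_2= (X\otimes(W_1\otimes_\infty W_2))^Y$, that is, there is an isomorphism in $\mathbf{FS}$ under which, for every smooth $g:\mathbb{R}^a\times\mathbb{R}^b\times Y\to X$, the class of $x_2\mapsto(y\mapsto[g(\cdot,x_2,y)])$ corresponds to $y\mapsto[g(\cdot,\cdot,y)]$. $\mathbf{FS}_{\mathbf{WE}}$ is the full subcategory of these spaces. $\mathbf{D}$ is the full subcategory of the category of $C^\infty$-rings on the objects $C=C^\infty(\mathbb{R}^n)\otimes_\infty W$ ($n\ge 0$, $W$ a Weil algebra), and $X\otimes C:=C^\infty(\mathbb{R}^n,X)\otimes W$. **Assumption (the conjecture).** $X\otimes C$ is functorial in $C$ for Weil-exponentiable $X$: every morphism $\psi:C^\infty(\mathbb{R}^n)\otimes_\infty W\to C^\infty(\mathbb{R}^{n'})\otimes_\infty W'$ of $\mathbf{D}$ induces a smooth map $X\otimes\psi:X\otimes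 C\to X\otimes C'$, given by $[f]\mapsto[f\circ p]$ for every smooth map $p:\mathbb{R}^{n'+k'}\to\mathbb{R}^{n+k}$ that represents $\psi$ (that is, $\psi[u]=[u\circ p]$ for all $u$; a smooth map $\mathbb{R}^k\to C^\infty(\mathbb{R}^n,X)$ is regarded here as a map $\mathbb{R}^{n+k}\to X$), and this is compatible with identities and composition in $\mathbf{D}$ and natural in $X$, so that $\otimes$ is a bifunctor on $\mathbf{FS}_{\mathbf{WE}}\times\mathbf{D}$. Let $\mathbf{J}:\mathbf{FS}_{\mathbf{WE}}\to\mathbf{Sets}^{\mathbf{D}}$, $\mathbf{J}(X)(C)=$ the underlying set of $X\otimes C$, be the exponential adjoint of the composite of $\otimes$ with the underlying-set functor. **Proposition.** Under this assumption, for every Weil-exponentiable Frölicher space $X$ and every object $C^\infty(\mathbb{R}^n)\otimes_\infty W$ of $\mathbf{D}$, the Frölicher space $X\otimes(C^\infty(\mathbb{R}^n)\otimes_\infty W)$ is Weil-exponentiable, and in $\mathbf{Sets}^{\mathbf{D}}$ there is an isomorphism $$\mathbf{J}(X)^{\hom_{\mathbf{D}}(C^\infty(\mathbb{R}^n)\otimes_\infty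 W,\,\cdot)}\;\cong\;\mathbf{J}\bigl(X\otimes(C^\infty(\mathbb{R}^n)\otimes_\infty W)\bigr).$$ -/

import Mathlib

open CategoryTheory
open scoped ContDiff

noncomputable section

namespace Cahiers

/-! ### The rings `C^∞(ℝⁿ)` -/

/-- The `ℝ`-algebra `C^∞(ℝⁿ)` of smooth real functions on `ℝⁿ`. -/
def smoothSubalgebra (n : ℕ) : Subalgebra ℝ ((Fin n → ℝ) → ℝ) where
  carrier := {f | ContDiff ℝ ∞ f}
  mul_mem' {f g} hf hg := by
    have hf : ContDiff ℝ ∞ f := hf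
    have hg : ContDiff ℝ ∞ g := hg
    exact ContDiff.mul hf hg
  add_mem' {f g} hf hg := by
    have hf : ContDiff ℝ ∞ f := hf
    have hg : ContDiff ℝ ∞ g := hg
    exact ContDiff.add hf hg
  algebraMap_mem' c := (contDiff_const : ContDiff ℝ ∞ fun _ : Fin n → ℝ => c)

/-- `C^∞(ℝⁿ)` as a type. -/
abbrev Cinf (n : ℕ) : Type := smoothSubalgebra n

namespace Cinf

theorem contDiff {n : ℕ} (f : Cinf n) : ContDiff ℝ ∞ f.1 := f.2

/-- The `i`-th coordinate function on `ℝⁿ`. -/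
def coord {n : ℕ} (i : Fin n) : Cinf n :=
  ⟨fun x => x i, (contDiff_apply ℝ ℝ i : ContDiff ℝ ∞ fun x : Fin n → ℝ => x i)⟩

/-- The smooth map `ℝᵐ → ℝⁿ` with the given components. -/
def toMap {n m : ℕ} (p : Fin n → Cinf m) (x : Fin m → ℝ) : Fin n → ℝ :=
  fun i => (p i).1 x

theorem contDiff_toMap {n m : ℕ} (p : Fin n → Cinf m) : ContDiff ℝ ∞ (toMap p) :=
  contDiff_pi.2 fun i => (p i).contDiff

/-- The composite of `f ∈ C^∞(ℝⁿ)` with the smooth map `p : ℝᵐ → ℝⁿ`. -/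
def comp {n m : ℕ} (f : Cinf n) (p : Fin n → Cinf m) : Cinf m :=
  ⟨fun x => f.1 (toMap p x), f.contDiff.comp (contDiff_toMap p)⟩

/-- Composition with `p : ℝᵐ → ℝⁿ`, as a ring homomorphism `C^∞(ℝⁿ) → C^∞(ℝᵐ)`. -/
def compHom {n m : ℕ} (p : Fin n → Cinf m) : Cinf n →+* Cinf m where
  toFun f := f.comp p
  map_one' := rfl
  map_mul' _ _ := rfl
  map_zero' := rfl
  map_add' _ _ := rfl

/-- The ideal of the functions that vanish at the origin. -/
def maxIdeal (n : ℕ) : Ideal (Cinf n) where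
  carrier := {f | f.1 0 = 0}
  add_mem' {f g} hf hg := by
    change f.1 0 + g.1 0 = 0
    rw [show f.1 0 = 0 from hf, show g.1 0 = 0 from hg, add_zero]
  zero_mem' := rfl
  smul_mem' c f hf := by
    change c.1 0 * f.1 0 = 0
    rw [show f.1 0 = 0 from hf, mul_zero]

/-- A parametric integral of a smooth function is smooth. -/
theorem contDiff_integral {E : Type} [NormedAddCommGroup E] [NormedSpace ℝ E]
    [FiniteDimensional ℝ E] (k : ℕ) :
    ∀ {G : Type} [NormedAddCommGroup G] [NormedSpace ℝ G] [CompleteSpace G]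
      (F : E × ℝ → G), ContDiff ℝ ∞ F →
      ContDiff ℝ k (fun x : E => ∫ t in (0 : ℝ)..1, F (x, t)) := by
  have key : ∀ {G : Type} [NormedAddCommGroup G] [NormedSpace ℝ G] [CompleteSpace G]
      (F : E × ℝ → G), ContDiff ℝ ∞ F → ∀ x₀ : E,
      HasFDerivAt (fun x : E => ∫ t in (0 : ℝ)..1, F (x, t))
        (∫ t in (0 : ℝ)..1, (fderiv ℝ F (x₀, t)).comp (ContinuousLinearMap.inl ℝ E ℝ)) x₀ := by
    intro G _ _ _ F hF x₀
    have hF' : Continuous fun q : E × ℝ =>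
        (fderiv ℝ F q).comp (ContinuousLinearMap.inl ℝ E ℝ) :=
      (hF.continuous_fderiv (by simp)).clm_comp continuous_const
    obtain ⟨K, hK⟩ := ((isCompact_closedBall x₀ 1).prod
      (isCompact_Icc (a := (0 : ℝ)) (b := 1))).exists_bound_of_continuousOn hF'.continuousOn
    refine intervalIntegral.hasFDerivAt_integral_of_dominated_of_fderiv_le
      (s := Metric.closedBall x₀ 1) (bound := fun _ => K)
      (F' := fun x t => (fderiv ℝ F (x, t)).comp (ContinuousLinearMap.inl ℝ E ℝ))
      (Metric.closedBall_mem_nhds x₀ one_pos) ?_ ?_ ?_ ?_ ?_ ?_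
    · exact Filter.Eventually.of_forall fun x =>
        (hF.continuous.comp (Continuous.prodMk_right x)).aestronglyMeasurable
    · exact (hF.continuous.comp (Continuous.prodMk_right x₀)).intervalIntegrable _ _
    · exact (hF'.comp (Continuous.prodMk_right x₀)).aestronglyMeasurable
    · refine Filter.Eventually.of_forall fun t ht x hx => hK (x, t) ⟨hx, ?_⟩
      rw [Set.uIoc_of_le zero_le_one] at ht
      exact ⟨ht.1.le, ht.2⟩
    · exact intervalIntegrable_const
    · refine Filter.Eventually.of_forall fun t _ x _ => ?_
      have h1 : HasFDerivAt F (fderiv ℝ F (x, t)) (x, t) :=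
        ((hF.differentiable (by simp)) (x, t)).hasFDerivAt
      exact h1.comp x (hasFDerivAt_prodMk_left x t)
  induction k with
  | zero =>
    intro G _ _ _ F hF
    rw [Nat.cast_zero, contDiff_zero]
    exact continuous_iff_continuousAt.2 fun x => (key F hF x).continuousAt
  | succ k ih =>
    intro G _ _ _ F hF
    rw [show ((k + 1 : ℕ) : ℕ∞ω) = (k : ℕ∞ω) + 1 by push_cast; rfl,
      contDiff_succ_iff_hasFDerivAt]
    exact ⟨_, ih _ ((hF.fderiv_right (by simp)).clm_comp contDiff_const),
      fun x => key F hF x⟩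

/-- Hadamard's lemma: `f ∘ u ≡ f ∘ v` modulo every ideal that contains all `uᵢ - vᵢ`. -/
theorem comp_sub_comp_mem {p N : ℕ} (I : Ideal (Cinf N)) (f : Cinf p) (u v : Fin p → Cinf N)
    (h : ∀ i, u i - v i ∈ I) : f.comp u - f.comp v ∈ I := by
  have hf : ContDiff ℝ ∞ f.1 := f.contDiff
  have hseg : ContDiff ℝ ∞ fun q : (Fin N → ℝ) × ℝ =>
      toMap v q.1 + q.2 • (toMap u q.1 - toMap v q.1) :=
    ((contDiff_toMap v).comp contDiff_fst).add
      (contDiff_snd.smul (((contDiff_toMap u).comp contDiff_fst).sub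
        ((contDiff_toMap v).comp contDiff_fst)))
  let H : Fin p → (Fin N → ℝ) × ℝ → ℝ := fun i q =>
    fderiv ℝ f.1 (toMap v q.1 + q.2 • (toMap u q.1 - toMap v q.1)) (Pi.single i 1)
  have hH : ∀ i, ContDiff ℝ ∞ (H i) := fun i =>
    ((hf.fderiv_right (m := ∞) (by simp)).comp hseg).clm_apply contDiff_const
  let g : Fin p → Cinf N := fun i =>
    ⟨fun x => ∫ t in (0 : ℝ)..1, H i (x, t),
      contDiff_infty.2 fun k => contDiff_integral k (H i) (hH i)⟩
  have hsum : f.comp u - f.comp v = ∑ i, g i * (u i - v i) := by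
    apply Subtype.ext
    funext x
    have h1 : (∑ i, g i * (u i - v i)).1 x
        = ∑ i, (∫ t in (0 : ℝ)..1, H i (x, t)) * (toMap u x i - toMap v x i) := by
      rw [AddSubmonoidClass.coe_finsetSum, Finset.sum_apply]
      rfl
    rw [h1]
    change f.1 (toMap u x) - f.1 (toMap v x) = _
    have hd : ∀ t : ℝ, HasDerivAt
        (fun t : ℝ => f.1 (toMap v x + t • (toMap u x - toMap v x)))
        (∑ i, H i (x, t) * (toMap u x i - toMap v x i)) t := by
      intro t
      have h2 : HasDerivAt (fun t : ℝ => toMap v x + t • (toMap u x - toMap v x))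
          (toMap u x - toMap v x) t := by
        simpa using ((hasDerivAt_id t).smul_const (toMap u x - toMap v x)).const_add (toMap v x)
      have h3 := ((hf.differentiable (by simp))
        (toMap v x + t • (toMap u x - toMap v x))).hasFDerivAt.comp_hasDerivAt t h2
      have hL : ∀ (L : (Fin p → ℝ) →L[ℝ] ℝ) (w : Fin p → ℝ),
          L w = ∑ i, L (Pi.single i 1) * w i := by
        intro L w
        conv_lhs => rw [← Finset.univ_sum_single w]
        rw [map_sum]
        refine Finset.sum_congr rfl fun i _ => ?_
        rw [show Pi.single i (w i) = w i • (Pi.single i 1 : Fin p → ℝ) by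
          rw [← Pi.single_smul]; simp, map_smul, smul_eq_mul, mul_comm]
      exact h3.congr_deriv (hL _ _)
    have hc : ∀ i, Continuous fun t : ℝ => H i (x, t) := fun i =>
      (hH i).continuous.comp (Continuous.prodMk_right x)
    have h4 := intervalIntegral.integral_eq_sub_of_hasDerivAt (a := (0 : ℝ)) (b := 1)
      (fun t _ => hd t)
      ((continuous_finsetSum _ fun i _ => (hc i).mul continuous_const).intervalIntegrable _ _)
    have h5 : ∀ i ∈ (Finset.univ : Finset (Fin p)), IntervalIntegrable
        (fun t : ℝ => H i (x, t) * (toMap u x i - toMap v x i)) MeasureTheory.volume 0 1 :=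
      fun i _ => ((hc i).mul continuous_const).intervalIntegrable _ _
    rw [intervalIntegral.integral_finsetSum h5] at h4
    simp only [intervalIntegral.integral_mul_const, one_smul, zero_smul, add_zero,
      add_sub_cancel] at h4
    exact h4.symm
  rw [hsum]
  exact Ideal.sum_mem _ fun i _ => I.mul_mem_left _ (h i)

/-- The projection `ℝᵃ⁺ᵇ → ℝᵃ`, by its components. -/
def fstMap (a b : ℕ) : Fin a → Cinf (a + b) := fun i => coord (Fin.castAdd b i)

/-- The projection `ℝᵃ⁺ᵇ → ℝᵇ`, by its components. -/
def sndMap (a b : ℕ) : Fin b → Cinf (a + b) := fun i => coord (Fin.natAdd a i)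

theorem maxIdeal_add_le (a b : ℕ) :
    maxIdeal (a + b) ≤
      (maxIdeal a).map (compHom (fstMap a b)) ⊔ (maxIdeal b).map (compHom (sndMap a b)) := by
  intro f hf
  set I := (maxIdeal a).map (compHom (fstMap a b)) ⊔ (maxIdeal b).map (compHom (sndMap a b))
  have h := comp_sub_comp_mem I f (fun i => coord i) (fun _ => 0) (fun i => by
    rw [sub_zero]
    refine Fin.addCases (fun j => ?_) (fun j => ?_) i
    · exact Ideal.mem_sup_left (Ideal.mem_map_of_mem (compHom (fstMap a b))
        (show coord j ∈ maxIdeal a from rfl))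
    · exact Ideal.mem_sup_right (Ideal.mem_map_of_mem (compHom (sndMap a b))
        (show coord j ∈ maxIdeal b from rfl)))
  have h0 : f.comp (fun _ => (0 : Cinf (a + b))) = 0 := by
    apply Subtype.ext
    funext x
    exact hf
  rw [h0, sub_zero] at h
  exact h

end Cinf

/-! ### `C^∞`-rings -/

/-- A `C^∞`-ring: a set `A` on which every smooth `f : ℝⁿ → ℝ` acts as an operation `Aⁿ → A`,
compatibly with projections and composition. -/
structure CInfRing where
  carrier : Type
  op : ∀ {n : ℕ}, Cinf n → (Fin n → carrier) → carrier
  op_coord : ∀ {n : ℕ} (i : Fin n) (a : Fin n → carrier), op (Cinf.coord i) a = a i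
  op_comp : ∀ {n m : ℕ} (f : Cinf n) (p : Fin n → Cinf m) (a : Fin m → carrier),
    op (f.comp p) a = op f fun i => op (p i) a

/-- A homomorphism of `C^∞`-rings. -/
@[ext]
structure CInfRing.Hom (A B : CInfRing) where
  toFun : A.carrier → B.carrier
  map_op : ∀ {n : ℕ} (f : Cinf n) (a : Fin n → A.carrier),
    toFun (A.op f a) = B.op f fun i => toFun (a i)

instance : Category CInfRing where
  Hom := CInfRing.Hom
  id A := ⟨fun a => a, fun _ _ => rfl⟩
  comp φ ψ := ⟨fun a => ψ.toFun (φ.toFun a), fun f a => by rw [φ.map_op, ψ.map_op]⟩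

/-- A presentation `C^∞(ℝⁿ)/I` of a (finitely generated) `C^∞`-ring. -/
structure Pres where
  dim : ℕ
  ideal : Ideal (Cinf dim)

namespace Pres

/-- The `C^∞`-ring `C^∞(ℝⁿ)/I`; the operations are those of `C^∞(ℝⁿ)` on representatives. -/
def ring (P : Pres) : CInfRing where
  carrier := Cinf P.dim ⧸ P.ideal
  op f a := Ideal.Quotient.mk P.ideal (f.comp fun i => (a i).out)
  op_coord i a := by
    change Ideal.Quotient.mk P.ideal ((a i).out) = a i
    exact Quotient.out_eq' (a i)
  op_comp f p a := by
    refine (Ideal.Quotient.eq.2 (Cinf.comp_sub_comp_mem P.ideal f _ _ fun i => ?_) :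
      Ideal.Quotient.mk P.ideal (f.comp fun i => (p i).comp fun j => (a j).out) = _)
    rw [← Ideal.Quotient.eq]
    exact (Quotient.out_eq' (Ideal.Quotient.mk P.ideal ((p i).comp fun j => (a j).out))).symm

theorem ring_op_mk (P : Pres) {n : ℕ} (f : Cinf n) (u : Fin n → Cinf P.dim) :
    P.ring.op f (fun i => Ideal.Quotient.mk P.ideal (u i)) =
      Ideal.Quotient.mk P.ideal (f.comp u) := by
  refine Ideal.Quotient.eq.2 (Cinf.comp_sub_comp_mem P.ideal f _ _ fun i => ?_)
  rw [← Ideal.Quotient.eq]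
  exact Quotient.out_eq' (Ideal.Quotient.mk P.ideal (u i))

/-- The free `C^∞`-ring `C^∞(ℝⁿ)`. -/
def free (n : ℕ) : Pres := ⟨n, ⊥⟩

/-- The coproduct `C^∞(ℝᵃ)/I ⊗_∞ C^∞(ℝᵇ)/J = C^∞(ℝᵃ⁺ᵇ)/(I, J)` of `C^∞`-rings. -/
def tensor (P Q : Pres) : Pres where
  dim := P.dim + Q.dim
  ideal := P.ideal.map (Cinf.compHom (Cinf.fstMap P.dim Q.dim)) ⊔
    Q.ideal.map (Cinf.compHom (Cinf.sndMap P.dim Q.dim))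

end Pres

/-- A Weil algebra `C^∞(ℝⁿ)/I`: the ideal `I` consists of functions vanishing at the origin and
contains a power of the ideal of all such functions. (Equivalently, the quotient is a local
`ℝ`-algebra of finite dimension with residue field `ℝ`, whose maximal ideal is generated by
the classes of the coordinates.) -/
structure WeilAlgebra extends Pres where
  le_maxIdeal : ideal ≤ Cinf.maxIdeal dim
  exists_pow_le : ∃ r : ℕ, Cinf.maxIdeal dim ^ r ≤ ideal

/-- The Weil algebra `W₁ ⊗_∞ W₂`. -/
def WeilAlgebra.tensor (W₁ W₂ : WeilAlgebra) : WeilAlgebra where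
  toPres := W₁.toPres.tensor W₂.toPres
  le_maxIdeal := by
    refine sup_le (Ideal.map_le_iff_le_comap.2 fun f hf => ?_)
      (Ideal.map_le_iff_le_comap.2 fun f hf => ?_)
    · exact (W₁.le_maxIdeal hf : f.1 0 = 0)
    · exact (W₂.le_maxIdeal hf : f.1 0 = 0)
  exists_pow_le := by
    obtain ⟨r, hr⟩ := W₁.exists_pow_le
    obtain ⟨s, hs⟩ := W₂.exists_pow_le
    refine ⟨r + s, (Ideal.pow_right_mono (Cinf.maxIdeal_add_le W₁.dim W₂.dim) _).trans
      (Ideal.sup_pow_add_le_pow_sup_pow.trans (sup_le_sup ?_ ?_))⟩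
    · rw [← Ideal.map_pow]
      exact Ideal.map_mono hr
    · rw [← Ideal.map_pow]
      exact Ideal.map_mono hs

/-- The data `(n, W)` of an object `C^∞(ℝⁿ) ⊗_∞ W`. -/
structure DObj where
  n : ℕ
  W : WeilAlgebra

/-- The presentation of `C^∞(ℝⁿ) ⊗_∞ W`. -/
def DObj.pres (C : DObj) : Pres := (Pres.free C.n).tensor C.W.toPres

/-- The `C^∞`-ring `C^∞(ℝⁿ) ⊗_∞ W`. -/
def DObj.ring (C : DObj) : CInfRing := C.pres.ring

/-- The full subcategory of the category of `C^∞`-rings on the objects `C^∞(ℝⁿ) ⊗_∞ W`. -/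
abbrev D : Type := InducedCategory CInfRing DObj.ring

/-- The object `C^∞(ℝⁿ) ⊗_∞ W` of `D`. -/
def D.of (n : ℕ) (W : WeilAlgebra) : D := (⟨n, W⟩ : DObj)

/-- For an object `C^∞(ℝⁿ) ⊗_∞ W` of `D`, the number `n`. -/
def D.n (C : D) : ℕ := DObj.n C

/-- For an object `C^∞(ℝⁿ) ⊗_∞ W` of `D`, the Weil algebra `W`. -/
def D.W (C : D) : WeilAlgebra := DObj.W C

/-- The smooth map `p : ℝⁿ'⁺ᵏ' → ℝⁿ⁺ᵏ` represents the `C^∞`-homomorphism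
`ψ : C^∞(ℝⁿ⁺ᵏ)/I → C^∞(ℝⁿ'⁺ᵏ')/I'`, that is, `ψ [u] = [u ∘ p]`. -/
def Represents {C C' : D} (ψ : C ⟶ C')
    (p : Fin (C.n + C.W.dim) → Cinf (C'.n + C'.W.dim)) : Prop :=
  ∀ u : Cinf (C.n + C.W.dim),
    ψ.hom.toFun (Ideal.Quotient.mk (DObj.pres C).ideal u) =
      Ideal.Quotient.mk (DObj.pres C').ideal (u.comp p)

/-! ### Frölicher spaces -/

/-- A Frölicher space: a set with curves and functions that determine each other. -/
structure FrolicherSpace where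
  carrier : Type
  curves : Set (ℝ → carrier)
  functions : Set (carrier → ℝ)
  mem_curves_iff : ∀ c, c ∈ curves ↔ ∀ f ∈ functions, ContDiff ℝ ∞ (f ∘ c)
  mem_functions_iff : ∀ f, f ∈ functions ↔ ∀ c ∈ curves, ContDiff ℝ ∞ (f ∘ c)

namespace FrolicherSpace

instance : CoeSort FrolicherSpace Type := ⟨carrier⟩

/-- The Frölicher structure generated by a set of functions. -/
def ofFunctions (T : Type) (S : Set (T → ℝ)) : FrolicherSpace where
  carrier := T
  curves := {c | ∀ f ∈ S, ContDiff ℝ ∞ (f ∘ c)}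
  functions := {f | ∀ c : ℝ → T, (∀ g ∈ S, ContDiff ℝ ∞ (g ∘ c)) → ContDiff ℝ ∞ (f ∘ c)}
  mem_curves_iff c := ⟨fun hc _ hf => hf c hc, fun h f hf => h f fun _ hc => hc f hf⟩
  mem_functions_iff _ := Iff.rfl

/-- The Frölicher structure generated by a set of curves. -/
def ofCurves (T : Type) (S : Set (ℝ → T)) : FrolicherSpace where
  carrier := T
  curves := {c | ∀ f : T → ℝ, (∀ e ∈ S, ContDiff ℝ ∞ (f ∘ e)) → ContDiff ℝ ∞ (f ∘ c)}
  functions := {f | ∀ c ∈ S, ContDiff ℝ ∞ (f ∘ c)}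
  mem_curves_iff _ := Iff.rfl
  mem_functions_iff f := ⟨fun hf _ hc => hc f hf, fun h c hc => h c fun _ hg => hg c hc⟩

/-- A smooth map of Frölicher spaces. -/
@[ext]
structure Hom (X Y : FrolicherSpace) where
  toFun : X → Y
  smooth : ∀ c ∈ X.curves, toFun ∘ c ∈ Y.curves

instance (X Y : FrolicherSpace) : CoeFun (Hom X Y) (fun _ => X → Y) := ⟨Hom.toFun⟩

/-- The identity map. -/
def Hom.id (X : FrolicherSpace) : Hom X X := ⟨fun x => x, fun _ hc => hc⟩

/-- The composite `g ∘ f`. -/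
def Hom.comp {X Y Z : FrolicherSpace} (g : Hom Y Z) (f : Hom X Y) : Hom X Z :=
  ⟨fun x => g (f x), fun c hc => g.smooth _ (f.smooth c hc)⟩

/-- The category `FS` of Frölicher spaces and smooth maps. -/
instance : Category FrolicherSpace where
  Hom := Hom
  id := Hom.id
  comp f g := Hom.comp g f

/-- The underlying-set functor. -/
def forget : FrolicherSpace ⥤ Type where
  obj X := X.carrier
  map f := TypeCat.ofHom (Hom.toFun f)

/-- The Frölicher space `ℝⁿ`; its curves are the smooth curves. -/
def Rn (n : ℕ) : FrolicherSpace :=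
  ofFunctions (Fin n → ℝ) (Set.range fun (i : Fin n) (x : Fin n → ℝ) => x i)

/-- The Frölicher space `ℝ`. -/
def R : FrolicherSpace := ofFunctions ℝ {fun x => x}

/-- A point of the Frölicher space `ℝ` as a real number. -/
def toReal (r : R) : ℝ := r

/-- The product of two Frölicher spaces. -/
def prod (X Y : FrolicherSpace) : FrolicherSpace :=
  ofFunctions (X × Y) ({h | ∃ f ∈ X.functions, h = fun q => f q.1} ∪
    {h | ∃ g ∈ Y.functions, h = fun q => g q.2})

/-- The Frölicher space `X^Y = C^∞(Y, X)`. Its structure is generated by the curves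
`c : ℝ → C^∞(Y, X)` for which `ℝ × Y → X`, `(t, y) ↦ c(t)(y)`, is smooth. -/
def mapSpace (Y X : FrolicherSpace) : FrolicherSpace :=
  ofCurves (Hom Y X)
    {c | ∀ d ∈ (prod R Y).curves, (fun t => (c (d t).1) (d t).2) ∈ X.curves}

/-- Evaluation of an element of `X^Y`. -/
def ev {Y X : FrolicherSpace} (f : mapSpace Y X) (y : Y) : X := (show Hom Y X from f) y

theorem mem_curves_Rn {n : ℕ} {c : ℝ → Rn n} :
    c ∈ (Rn n).curves ↔ ∀ i : Fin n, ContDiff ℝ ∞ fun t => (show Fin n → ℝ from c t) i :=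
  Set.forall_mem_range

/-- A smooth function on `ℝⁿ` as a smooth map of Frölicher spaces. -/
def ofCinf {n : ℕ} (u : Cinf n) : Hom (Rn n) R where
  toFun := u.1
  smooth c hc f hf := by
    rw [Set.mem_singleton_iff] at hf
    subst hf
    exact u.contDiff.comp (contDiff_pi.2 (mem_curves_Rn.1 hc))

/-- The partial map `g(·, x₂, y)` of a smooth map `g` on `ℝᵃ⁺ᵇ × Y`. -/
def slice {a b : ℕ} {Y X : FrolicherSpace} (g : Hom (prod (Rn (a + b)) Y) X)
    (x₂ : Rn b) (y : Y) : Hom (Rn a) X :=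
  g.comp ⟨fun x₁ => (Fin.append (α := ℝ) x₁ x₂, y), by
    rintro c hc f (⟨f, hf, rfl⟩ | ⟨f, hf, rfl⟩)
    · refine ((Rn (a + b)).mem_functions_iff f).1 hf
        (fun t => Fin.append (α := ℝ) (c t) x₂) (mem_curves_Rn.2 fun i => ?_)
      refine Fin.addCases (fun j => ?_) (fun j => ?_) i
      · exact (congrArg (ContDiff ℝ ∞) (funext fun t =>
          Fin.append_left (α := ℝ) (c t) x₂ j)).mpr (mem_curves_Rn.1 hc j)
      · exact (congrArg (ContDiff ℝ ∞) (funext fun t =>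
          Fin.append_right (α := ℝ) (c t) x₂ j)).mpr contDiff_const
    · exact (contDiff_const : ContDiff ℝ ∞ fun _ : ℝ => f y)⟩

/-- The partial map `g(·, y)` of a smooth map `g` on `ℝⁿ × Y`. -/
def sliceLeft {n : ℕ} {Y X : FrolicherSpace} (g : Hom (prod (Rn n) Y) X) (y : Y) :
    Hom (Rn n) X :=
  g.comp ⟨fun x => (x, y), by
    rintro c hc f (⟨f, hf, rfl⟩ | ⟨f, hf, rfl⟩)
    · exact ((Rn n).mem_functions_iff f).1 hf c hc
    · exact (contDiff_const : ContDiff ℝ ∞ fun _ : ℝ => f y)⟩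

/-! ### Weil prolongation -/

/-- The equivalence relation `f ≡ g mod I` on `C^∞(ℝⁿ, X)`, for `W = C^∞(ℝⁿ)/I`. -/
def weilSetoid (X : FrolicherSpace) (W : WeilAlgebra) : Setoid (Hom (Rn W.dim) X) where
  r f g := f (fun _ => (0 : ℝ)) = g (fun _ => (0 : ℝ)) ∧
    ∀ χ : Hom X R, ∃ u ∈ W.ideal, ∀ x : Fin W.dim → ℝ, u.1 x = toReal (χ (f x)) - toReal (χ (g x))
  iseqv :=
    { refl := fun f => ⟨rfl, fun χ => ⟨0, W.ideal.zero_mem, fun _ => (sub_self _).symm⟩⟩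
      symm := fun {f g} h => ⟨h.1.symm, fun χ => by
        obtain ⟨u, hu, h'⟩ := h.2 χ
        exact ⟨-u, W.ideal.neg_mem hu, fun x => by
          change -u.1 x = _
          rw [h' x, neg_sub]⟩⟩
      trans := fun {f g k} h₁ h₂ => ⟨h₁.1.trans h₂.1, fun χ => by
        obtain ⟨u, hu, h'⟩ := h₁.2 χ
        obtain ⟨v, hv, h''⟩ := h₂.2 χ
        exact ⟨u + v, W.ideal.add_mem hu hv, fun x => by
          change u.1 x + v.1 x = _
          rw [h' x, h'' x, sub_add_sub_cancel]⟩⟩ }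

/-- The underlying set of the Weil prolongation `X ⊗ W`. -/
def ProlSet (X : FrolicherSpace) (W : WeilAlgebra) : Type := Quotient (weilSetoid X W)

/-- The map `φ ⊗ W : X ⊗ W → Y ⊗ W`, `[f] ↦ [φ ∘ f]`, on underlying sets. -/
def prolSetMap {X Y : FrolicherSpace} (φ : Hom X Y) (W : WeilAlgebra) :
    ProlSet X W → ProlSet Y W :=
  Quotient.map (fun f => φ.comp f) fun _ _ h =>
    ⟨congrArg φ.toFun h.1, fun χ => h.2 (χ.comp φ)⟩

/-- The set `ℝ ⊗ W = W` with the Frölicher structure of a finite-dimensional real vector space: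
its functions are generated by the linear functionals on `C^∞(ℝⁿ)/I`, i.e. by the linear
functionals on `C^∞(ℝⁿ)` that vanish on `I`. -/
def realProl (W : WeilAlgebra) : FrolicherSpace :=
  ofFunctions (ProlSet R W)
    {v | ∃ l : Cinf W.dim →ₗ[ℝ] ℝ, (∀ u ∈ W.ideal, l u = 0) ∧
      ∀ u : Cinf W.dim, v (Quotient.mk _ (ofCinf u)) = l u}

/-- The Weil prolongation `X ⊗ W`, with the initial structure with respect to the maps
`χ ⊗ W : X ⊗ W → ℝ ⊗ W`, where `χ ∈ C^∞(X, ℝ)`. -/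
def prol (X : FrolicherSpace) (W : WeilAlgebra) : FrolicherSpace :=
  ofFunctions (ProlSet X W)
    {h | ∃ (χ : Hom X R) (v : ProlSet R W → ℝ),
      v ∈ (realProl W).functions ∧ h = v ∘ prolSetMap χ W}

/-- The class in `X ⊗ W` of a smooth map `f : ℝⁿ → X`. -/
def cls {X : FrolicherSpace} (W : WeilAlgebra) (f : Hom (Rn W.dim) X) : prol X W :=
  Quotient.mk (weilSetoid X W) f

/-- The smooth map `φ ⊗ W : X ⊗ W → Y ⊗ W`. -/
def prolMap {X Y : FrolicherSpace} (φ : Hom X Y) (W : WeilAlgebra) :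
    Hom (prol X W) (prol Y W) where
  toFun := prolSetMap φ W
  smooth c hc := by
    rintro _ ⟨χ, v, hv, rfl⟩
    have h := hc _ ⟨χ.comp φ, v, hv, rfl⟩
    have e : (v ∘ prolSetMap χ W) ∘ prolSetMap φ W ∘ c
        = (v ∘ prolSetMap (χ.comp φ) W) ∘ c := by
      funext t
      refine Quotient.inductionOn (motive := fun q =>
        v (prolSetMap χ W (prolSetMap φ W q)) = v (prolSetMap (χ.comp φ) W q)) (c t) ?_
      intro f
      rfl
    exact (congrArg (ContDiff ℝ ∞) e).mpr h

/-- `X` is Weil-exponentiable if `(X ⊗ (W₁ ⊗_∞ W₂))^Y = (X ⊗ W₁)^Y ⊗ W₂` for all Frölicher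
spaces `Y` and all Weil algebras `W₁`, `W₂`. Here "`=`" means the canonical identification: an
isomorphism of Frölicher spaces under which, for every smooth `g : ℝᵃ × ℝᵇ × Y → X`, the class of
`x₂ ↦ (y ↦ [g(·, x₂, y)])` corresponds to `y ↦ [g(·, ·, y)]`. -/
def IsWeilExponentiable : ObjectProperty FrolicherSpace := fun X =>
  ∀ (Y : FrolicherSpace) (W₁ W₂ : WeilAlgebra),
    ∃ (Φ : prol (mapSpace Y (prol X W₁)) W₂ ≅ mapSpace Y (prol X (W₁.tensor W₂))),
      ∀ (g : Hom (prod (Rn (W₁.dim + W₂.dim)) Y) X)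
        (h : Hom (Rn W₂.dim) (mapSpace Y (prol X W₁))),
        (∀ x₂ y, ev (h x₂) y = cls W₁ (slice g x₂ y)) →
        ∀ y, ev (Hom.toFun Φ.hom (cls W₂ h)) y = cls (W₁.tensor W₂) (sliceLeft g y)

/-- Postcomposition `φ^Y : X^Y → X'^Y`. -/
def mapSpaceMap (Y : FrolicherSpace) {X X' : FrolicherSpace} (φ : Hom X X') :
    Hom (mapSpace Y X) (mapSpace Y X') where
  toFun f := φ.comp f
  smooth _ hc f hf := hc (fun k => f (φ.comp k)) fun e he =>
    hf (fun t => φ.comp (e t)) fun d hd => φ.smooth _ (he d hd)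

/-- The space `X ⊗ C = C^∞(ℝⁿ, X) ⊗ W` for an object `C = C^∞(ℝⁿ) ⊗_∞ W` of `D`. -/
def ext (X : FrolicherSpace) (C : D) : FrolicherSpace := prol (mapSpace (Rn C.n) X) C.W

/-- The functoriality of `X ⊗ C` in `X`. -/
def extMap {X X' : FrolicherSpace} (φ : Hom X X') (C : D) : Hom (X.ext C) (X'.ext C) :=
  prolMap (mapSpaceMap (Rn C.n) φ) C.W

theorem extMap_id (X : FrolicherSpace) (C : D) : extMap (Hom.id X) C = Hom.id (X.ext C) := by
  apply Hom.ext
  funext q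
  refine Quotient.inductionOn (motive := fun q => (extMap (Hom.id X) C).toFun q = q) q ?_
  intro f
  rfl

theorem extMap_comp {X X' X'' : FrolicherSpace} (φ : Hom X X') (φ' : Hom X' X'') (C : D) :
    extMap (φ'.comp φ) C = (extMap φ' C).comp (extMap φ C) := by
  apply Hom.ext
  funext q
  refine Quotient.inductionOn (motive := fun q => (extMap (φ'.comp φ) C).toFun q =
    (extMap φ' C).toFun ((extMap φ C).toFun q)) q ?_
  intro f
  rfl

/-- The value at `(y, x) ∈ ℝⁿ × ℝᵏ = ℝⁿ⁺ᵏ` of a smooth map `f : ℝᵏ → C^∞(ℝⁿ, X)`. -/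
def uncurry {n k : ℕ} {X : FrolicherSpace} (f : Hom (Rn k) (mapSpace (Rn n) X))
    (z : Fin (n + k) → ℝ) : X :=
  ev (f fun i => z (Fin.natAdd n i)) (fun i => z (Fin.castAdd k i))

end FrolicherSpace

open FrolicherSpace

/-- The full subcategory `FS_WE` of Weil-exponentiable Frölicher spaces. -/
abbrev FSWE := IsWeilExponentiable.FullSubcategory

/-- The functoriality of `X ⊗ C = C^∞(ℝⁿ, X) ⊗ W` in `C`, for Weil-exponentiable `X`: every
morphism `ψ : C → C'` of `D` induces a smooth map `X ⊗ ψ : X ⊗ C → X ⊗ C'`, which is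
`[f] ↦ [f ∘ p]` whenever the smooth map `p : ℝⁿ'⁺ᵏ' → ℝⁿ⁺ᵏ` represents `ψ` (where
`f : ℝᵏ → C^∞(ℝⁿ, X)` is viewed as a map `ℝⁿ⁺ᵏ → X`), so that `⊗` becomes a bifunctor. -/
structure ExtFunctoriality where
  map : ∀ (X : FSWE) {C C' : D}, (C ⟶ C') → Hom (X.obj.ext C) (X.obj.ext C')
  map_cls : ∀ (X : FSWE) {C C' : D} (ψ : C ⟶ C')
    (p : Fin (C.n + C.W.dim) → Cinf (C'.n + C'.W.dim)), Represents ψ p →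
    ∀ (f : Hom (Rn C.W.dim) (mapSpace (Rn C.n) X.obj))
      (f' : Hom (Rn C'.W.dim) (mapSpace (Rn C'.n) X.obj)),
      (∀ z, uncurry f' z = uncurry f (Cinf.toMap p z)) →
      map X ψ (cls C.W f) = cls C'.W f'
  map_id : ∀ (X : FSWE) (C : D), map X (𝟙 C) = Hom.id (X.obj.ext C)
  map_comp : ∀ (X : FSWE) {C C' C'' : D} (ψ : C ⟶ C') (ψ' : C' ⟶ C''),
    map X (ψ ≫ ψ') = (map X ψ').comp (map X ψ)
  naturality : ∀ {X X' : FSWE} (φ : X ⟶ X') {C C' : D} (ψ : C ⟶ C'),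
    (extMap φ.hom C').comp (map X ψ) = (map X' ψ).comp (extMap φ.hom C)

namespace ExtFunctoriality

/-- The bifunctor `⊗ : FS_WE × D → FS`. -/
def bifunctor (E : ExtFunctoriality) : FSWE × D ⥤ FrolicherSpace where
  obj q := q.1.obj.ext q.2
  map {q q'} m := (E.map q'.1 m.2).comp (extMap m.1.hom q.2)
  map_id q := by
    change (E.map q.1 (𝟙 q.2)).comp (extMap (Hom.id q.1.obj) q.2) = Hom.id _
    rw [E.map_id, extMap_id]
    rfl
  map_comp {q q' q''} m m' := by
    change (E.map q''.1 (m.2 ≫ m'.2)).comp (extMap (Hom.comp m'.1.hom m.1.hom) q.2) =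
      ((E.map q''.1 m'.2).comp (extMap m'.1.hom q'.2)).comp
        ((E.map q'.1 m.2).comp (extMap m.1.hom q.2))
    rw [E.map_comp, extMap_comp]
    have h := E.naturality m'.1 m.2
    apply Hom.ext
    funext x
    exact congrArg (E.map q''.1 m'.2).toFun
      (congrFun (congrArg Hom.toFun h) ((extMap m.1.hom q.2).toFun x)).symm

/-- The functor `J : FS_WE → Sets^D`, exponential adjoint to the composite of the bifunctor
`⊗` with the underlying-set functor. -/
def J (E : ExtFunctoriality) : FSWE ⥤ D ⥤ Type :=
  Functor.curry.obj (E.bifunctor ⋙ FrolicherSpace.forget)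

end ExtFunctoriality

end Cahiers

end

open Cahiers

/-! Write `C` for the given object. In `D` the coproduct of `C` and `C'` exists: it is `C ⊗_∞ C'`,
with Euclidean dimensions added and Weil algebras tensored. The product of the functors represented
by `C` and `C'` is therefore represented by `C ⊗_∞ C'`, and Yoneda identifies the value at `C'` of
the exponential of `J(X)` with `X ⊗ (C ⊗_∞ C')` (`nonempty_functorHom_iso`). It remains to identify
this set with `(X ⊗ C) ⊗ C'`, naturally in `C'`.

Weil-exponentiability of `X` passes to `X^Z` (replace `Y` by `Z × Y`) and to `X ⊗ W` (use `(X ⊗ W) ⊗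
W₁ = X ⊗ (W ⊗_∞ W₁)`), hence to `X ⊗ C`. It also gives `(X^(ℝⁿ) ⊗ W)^(ℝⁿ') ⊗ W' = (X^(ℝⁿ) ⊗ (W ⊗_∞
W'))^(ℝⁿ') = X^(ℝⁿ⁺ⁿ') ⊗ (W ⊗_∞ W')`, which is `exists_ext_diffeo`. Naturality (`diffeo_natural`) is
checked on representatives: smooth maps into a Weil prolongation lift to smooth families
(`exists_lift`), and both composites substitute the same smooth map into the same representative.

These manipulations need the exponential law in `FS`, that is, smoothness of evaluation `X^Y × Y →
X` (`ev_mem_curves`). The difficulty is that `X^Y` is only generated by the curves with smooth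
uncurrying, so it must be shown that no further curves arise. This is the analytic part. By Boman's
theorem (`contDiff_of_curves`), `ℓ¹`-combinations of point values of derivatives of `φ ∘ k ∘ η` are
admissible functions of `k`. An arbitrary curve is smooth against all of them, the uniform
boundedness principle turns this into bounds on derivatives, and a Fourier argument turns bounds on
pure directional derivatives into joint smoothness. -/

noncomputable section

namespace Cahiers

/-! ### Smoothness from bounds on pure directional derivatives, by Fourier transform. -/

section Fourier

open MeasureTheory FourierTransform Real

theorem hasLineDerivAt_fourierChar_inner {E : Type*} [NormedAddCommGroup E]
    [InnerProductSpace ℝ E] (v ξ x : E) :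
    HasLineDerivAt ℝ (fun y : E => (𝐞 (-inner ℝ y ξ) : ℂ))
      (-(2 * π * Complex.I * (inner ℝ v ξ : ℝ)) * (𝐞 (-inner ℝ x ξ) : ℂ)) x v := by
  have h1 : HasDerivAt (fun t : ℝ => -inner ℝ (x + t • v) ξ) (-(inner ℝ v ξ : ℝ)) 0 := by
    simp only [inner_add_left, real_inner_smul_left]
    exact (((hasDerivAt_id (0 : ℝ)).mul_const (inner ℝ v ξ)).const_add
      (inner ℝ x ξ)).neg.congr_deriv (by simp)
  have h2 := (hasDerivAt_fourierChar (-inner ℝ (x + (0 : ℝ) • v) ξ)).scomp (0 : ℝ) h1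
  unfold HasLineDerivAt
  refine h2.congr_deriv ?_
  rw [zero_smul, add_zero, Complex.real_smul]
  push_cast
  ring

variable {E : Type*} [NormedAddCommGroup E] [InnerProductSpace ℝ E] [FiniteDimensional ℝ E]
  [MeasurableSpace E] [BorelSpace E]

/-- The Fourier transform turns a derivative in the direction `v` into a multiplication. -/
theorem fourier_of_hasLineDerivAt {f g : E → ℂ} {v : E} (hf : Integrable f) (hg : Integrable g)
    (h : ∀ x, HasLineDerivAt ℝ f (g x) x v) (ξ : E) :
    𝓕 g ξ = 2 * π * Complex.I * (inner ℝ v ξ : ℝ) * 𝓕 f ξ := by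
  have e : ∀ u : E → ℂ, Integrable u → Integrable (fun x => (𝐞 (-inner ℝ x ξ) : ℂ) * u x) := by
    intro u hu
    have := (Real.fourierIntegral_convergent_iff (f := u) (μ := volume) ξ).2 hu
    simpa [Circle.smul_def] using this
  have key := integral_bilinear_hasLineDerivAt_right_eq_neg_left_of_integrable (μ := volume)
    (f := fun y : E => (𝐞 (-inner ℝ y ξ) : ℂ))
    (f' := fun x => -(2 * π * Complex.I * (inner ℝ v ξ : ℝ)) * (𝐞 (-inner ℝ x ξ) : ℂ))
    (g := f) (g' := g) (v := v) (B := ContinuousLinearMap.mul ℝ ℂ)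
    (by simpa [mul_assoc] using ((e f hf).const_mul (-(2 * π * Complex.I * (inner ℝ v ξ : ℝ)))))
    (by simpa using e g hg) (by simpa using e f hf)
    (fun x _ => hasLineDerivAt_fourierChar_inner v ξ x) (fun x _ => h x)
  rw [Real.fourier_eq, Real.fourier_eq]
  simp only [Circle.smul_def, smul_eq_mul]
  simp only [ContinuousLinearMap.mul_apply'] at key
  rw [key, ← integral_neg, ← integral_const_mul]
  congr 1
  funext x
  ring

/-- A continuous function of compact support whose iterated derivatives in the directions of an
orthonormal basis exist and are integrable is smooth. -/
theorem contDiff_of_integrable_lineDeriv {ι : Type*} [Fintype ι] (b : OrthonormalBasis ι ℝ E)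
    (f : E → ℂ) (hf : Continuous f) (G : ι → ℕ → E → ℂ) (hG0 : ∀ i, G i 0 = f)
    (hG : ∀ i p x, HasLineDerivAt ℝ (G i p) (G i (p + 1) x) x (b i))
    (hint : ∀ i p, Integrable (G i p)) (hfi : Integrable f) : ContDiff ℝ ∞ f := by
  have hpow : ∀ i p ξ, 𝓕 (G i p) ξ = (2 * π * Complex.I * (inner ℝ (b i) ξ : ℝ)) ^ p * 𝓕 f ξ := by
    intro i p ξ
    induction p with
    | zero => simp [hG0]
    | succ p ih =>
      rw [fourier_of_hasLineDerivAt (hint i p) (hint i (p + 1)) (hG i p), ih]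
      ring
  have hb : ∀ i p ξ, |inner ℝ (b i) ξ| ^ p * ‖𝓕 f ξ‖ ≤ ∫ x, ‖G i p x‖ := by
    intro i p ξ
    have h1 : ‖𝓕 (G i p) ξ‖ ≤ ∫ x, ‖G i p x‖ :=
      VectorFourier.norm_fourierIntegral_le_integral_norm _ _ _ _ _
    rw [hpow, norm_mul, norm_pow] at h1
    refine le_trans (mul_le_mul_of_nonneg_right (pow_le_pow_left₀ (abs_nonneg _) ?_ p)
      (norm_nonneg _)) h1
    simp only [norm_mul, Complex.norm_I, Complex.norm_real, Real.norm_eq_abs, mul_one,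
      Complex.norm_ofNat, abs_of_pos Real.pi_pos]
    have : (1 : ℝ) ≤ 2 * π := by linarith [Real.pi_gt_three]
    nlinarith [abs_nonneg (inner ℝ (b i) ξ)]
  have hn : ∀ ξ, ‖ξ‖ ≤ ∑ i, |inner ℝ (b i) ξ| := by
    intro ξ
    conv_lhs => rw [← b.sum_repr' ξ]
    refine (norm_sum_le _ _).trans (Finset.sum_le_sum fun i _ => ?_)
    simp [norm_smul]
  have hdec : ∀ p : ℕ, ∃ C : ℝ, ∀ ξ, ‖ξ‖ ^ p * ‖𝓕 f ξ‖ ≤ C := by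
    intro p
    -- The power-mean inequality used below bounds only positive powers of a sum, so exponent zero
    -- is treated apart.
    rcases p with _ | p
    · exact ⟨∫ x, ‖f x‖, fun ξ => by
        rw [pow_zero, one_mul]
        exact VectorFourier.norm_fourierIntegral_le_integral_norm _ _ _ f ξ⟩
    refine ⟨(Fintype.card ι : ℝ) ^ p * ∑ i, ∫ x, ‖G i (p + 1) x‖, fun ξ => ?_⟩
    calc ‖ξ‖ ^ (p + 1) * ‖𝓕 f ξ‖
        ≤ (∑ i, |inner ℝ (b i) ξ|) ^ (p + 1) * ‖𝓕 f ξ‖ := by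
          gcongr
          exact hn ξ
      _ ≤ ((Fintype.card ι : ℝ) ^ p * ∑ i, |inner ℝ (b i) ξ| ^ (p + 1)) * ‖𝓕 f ξ‖ := by
          gcongr
          exact pow_sum_le_card_mul_sum_pow (fun i _ => abs_nonneg _) p
      _ ≤ _ := by
          rw [mul_assoc, Finset.sum_mul]
          gcongr with i
          exact hb i (p + 1) ξ
  have hcont : Continuous (𝓕 f) :=
    VectorFourier.fourierIntegral_continuous Real.continuous_fourierChar continuous_inner hfi
  have hI : ∀ p : ℕ, Integrable (fun ξ => ‖ξ‖ ^ p * ‖𝓕 f ξ‖) := by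
    intro p
    -- An integer exponent above the dimension makes `(1 + ‖ξ‖) ^ (-N)` integrable. Bounds on the
    -- moments of orders `p` and `p + N` then dominate the integrand by a multiple of it.
    let N := Module.finrank ℝ E + 1
    obtain ⟨C0, h0⟩ := hdec p
    obtain ⟨C1, h1⟩ := hdec (p + N)
    have hN : Integrable (fun x : E => (2 ^ N * (C0 + C1)) * (1 + ‖x‖) ^ (-(N : ℝ))) :=
      (integrable_one_add_norm (by simp [N])).const_mul _
    refine hN.mono' ((continuous_norm.pow p).mul hcont.norm).aestronglyMeasurable
      (Filter.Eventually.of_forall fun ξ => ?_)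
    rw [Real.norm_of_nonneg (by positivity), Real.rpow_neg (by positivity), Real.rpow_natCast,
      ← div_eq_mul_inv, le_div_iff₀ (by positivity)]
    have h2 : (1 + ‖ξ‖) ^ N ≤ 2 ^ N * (1 + ‖ξ‖ ^ N) := by
      rcases le_total ‖ξ‖ 1 with h | h
      · calc (1 + ‖ξ‖) ^ N ≤ 2 ^ N := by gcongr; linarith
          _ ≤ _ := le_mul_of_one_le_right (by positivity) (by simp)
      · calc (1 + ‖ξ‖) ^ N ≤ (2 * ‖ξ‖) ^ N := by gcongr; linarith
          _ = 2 ^ N * ‖ξ‖ ^ N := mul_pow _ _ _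
          _ ≤ _ := by gcongr; linarith
    calc ‖ξ‖ ^ p * ‖𝓕 f ξ‖ * (1 + ‖ξ‖) ^ N
        ≤ ‖ξ‖ ^ p * ‖𝓕 f ξ‖ * (2 ^ N * (1 + ‖ξ‖ ^ N)) := by gcongr
      _ = 2 ^ N * (‖ξ‖ ^ p * ‖𝓕 f ξ‖ + ‖ξ‖ ^ (p + N) * ‖𝓕 f ξ‖) := by ring
      _ ≤ _ := by
        gcongr
        · exact h0 ξ
        · exact h1 ξ
  have hFI : Integrable (𝓕 f) := by
    have := hI 0
    simp only [pow_zero, one_mul] at this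
    exact (integrable_norm_iff hcont.aestronglyMeasurable).1 this
  -- A function all of whose moments are integrable has a smooth transform; by inversion the double
  -- transform is `f` up to reflection.
  have hsm : ContDiff ℝ ∞ (𝓕 (𝓕 f)) := Real.contDiff_fourier fun n _ => hI n
  have hinv := hf.fourierInv_fourier_eq hfi hFI
  rw [← hinv]
  have : 𝓕⁻ (𝓕 f) = fun x => 𝓕 (𝓕 f) (-x) := by
    funext x
    exact Real.fourierInv_eq_fourier_neg _ _
  rw [this]
  exact hsm.comp contDiff_neg

theorem hasDerivAt_iteratedDeriv {F : Type*} [NormedAddCommGroup F] [NormedSpace ℝ F] {g : ℝ → F}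
    (hg : ContDiff ℝ ∞ g) (p : ℕ) (t : ℝ) :
    HasDerivAt (iteratedDeriv p g) (iteratedDeriv (p + 1) g t) t := by
  rw [iteratedDeriv_succ]
  exact ((hg.differentiable_iteratedDeriv p (mod_cast WithTop.coe_lt_top _)) t).hasDerivAt

/-- A continuous real function of compact support whose iterated derivatives in the directions of
an orthonormal basis exist and are bounded is smooth. -/
theorem contDiff_of_bounded_iteratedDeriv {ι : Type*} [Fintype ι] (b : OrthonormalBasis ι ℝ E)
    (f : E → ℝ) (hf : Continuous f) (hc : HasCompactSupport f)
    (hs : ∀ i x, ContDiff ℝ ∞ fun s : ℝ => f (x + s • b i))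
    (hb : ∀ i p, ∃ C : ℝ, ∀ x, |iteratedDeriv p (fun s : ℝ => f (x + s • b i)) 0| ≤ C) :
    ContDiff ℝ ∞ f := by
  let g : ι → ℕ → E → ℝ := fun i p x => iteratedDeriv p (fun s : ℝ => f (x + s • b i)) 0
  have hg0 : ∀ i, g i 0 = f := fun i => by
    funext x
    simp [g]
  have hshift : ∀ i p x (t : ℝ),
      g i p (x + t • b i) = iteratedDeriv p (fun s : ℝ => f (x + s • b i)) t := by
    intro i p x t
    have h := congrFun (iteratedDeriv_comp_const_add p (fun s : ℝ => f (x + s • b i)) t) 0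
    simp only [add_zero] at h
    rw [← h]
    simp only [g, add_smul, add_assoc]
  have hder : ∀ i p x, HasLineDerivAt ℝ (g i p) (g i (p + 1) x) x (b i) := by
    intro i p x
    have h := hasDerivAt_iteratedDeriv (hs i x) p 0
    unfold HasLineDerivAt
    rw [funext (hshift i p x)]
    exact h
  -- Nothing is known about the continuity of the derivatives in `x`, but each is a pointwise limit
  -- of difference quotients of the previous one. Measurability, boundedness and compact support are
  -- enough for integrability.
  have hmeas : ∀ i p, Measurable (g i p) := by
    intro i p
    induction p with
    | zero => rw [hg0]; exact hf.measurable
    | succ p ih =>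
      refine measurable_of_tendsto_metrizable
        (f := fun (n : ℕ) x => ((1 : ℝ) / (n + 1))⁻¹ •
          (g i p (x + ((1 : ℝ) / (n + 1)) • b i) - g i p x))
        (fun n => by fun_prop) ?_
      rw [tendsto_pi_nhds]
      intro x
      have h := (hder i p x).tendsto_slope_zero_right
      have h1 : Filter.Tendsto (fun n : ℕ => (1 : ℝ) / (n + 1)) Filter.atTop
          (nhdsWithin 0 (Set.Ioi 0)) :=
        tendsto_nhdsWithin_iff.2 ⟨tendsto_one_div_add_atTop_nhds_zero_nat,
          Filter.Eventually.of_forall fun n => by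
            simp only [Set.mem_Ioi]
            positivity⟩
      have h2 := h.comp h1
      simpa [Function.comp_def] using h2
  have hsupp : ∀ i p, Function.support (g i p) ⊆ tsupport f := by
    intro i p x hx
    by_contra hxf
    apply hx
    have h1 : (fun s : ℝ => f (x + s • b i)) =ᶠ[nhds 0] fun _ => 0 := by
      have h2 : Continuous fun s : ℝ => x + s • b i := by fun_prop
      have h3 := h2.tendsto 0
      rw [zero_smul, add_zero] at h3
      exact h3.eventually (notMem_tsupport_iff_eventuallyEq.1 hxf)
    change iteratedDeriv p _ 0 = 0
    rw [h1.iteratedDeriv_eq p]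
    simp
  have hint : ∀ i p, Integrable (g i p) := by
    intro i p
    obtain ⟨C, hC⟩ := hb i p
    rw [← integrableOn_iff_integrable_of_support_subset (hsupp i p)]
    exact Measure.integrableOn_of_bounded (M := C) hc.isCompact.measure_lt_top.ne
      (hmeas i p).aestronglyMeasurable (Filter.Eventually.of_forall fun x => hC x)
  have key : ContDiff ℝ ∞ fun x => (f x : ℂ) :=
    contDiff_of_integrable_lineDeriv b _ (Complex.continuous_ofReal.comp hf)
      (fun i p x => (g i p x : ℂ)) (fun i => by simp only [hg0])
      (fun i p x => HasDerivAt.ofReal_comp (hder i p x)) (fun i p => (hint i p).ofReal)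
      (hf.integrable_of_hasCompactSupport hc).ofReal
  exact Complex.reCLM.contDiff.comp key

end Fourier

/-! ### The special curve lemma and local bounds on directional derivatives. -/

section Boman

open Filter Topology

variable {E : Type*} [NormedAddCommGroup E] [NormedSpace ℝ E]

theorem exists_bound_iteratedFDeriv {F G : Type*} [NormedAddCommGroup F] [NormedSpace ℝ F]
    [NormedAddCommGroup G] [NormedSpace ℝ G] {f : F → G} (hf : ContDiff ℝ ∞ f)
    (hc : HasCompactSupport f) (k : ℕ) : ∃ C : ℝ, ∀ x, ‖iteratedFDeriv ℝ k f x‖ ≤ C :=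
  (hc.iteratedFDeriv k).exists_bound_of_continuous
    (hf.continuous_iteratedFDeriv (mod_cast le_top))

/-- The **special curve lemma**: a sequence of points converging fast enough to `x` lies on a
smooth curve that passes through the points with prescribed small velocities. -/
theorem exists_special_curve [CompleteSpace E] :
    ∃ (t ε : ℕ → ℝ), (∀ n, t n ∈ Set.Icc (0 : ℝ) 1) ∧ (∀ n, 0 < ε n) ∧
      ∀ (x : E) (y v : ℕ → E), (∀ n, ‖y n - x‖ ≤ ε n) → (∀ n, ‖v n‖ ≤ 1) →
        ∃ c : ℝ → E, ContDiff ℝ ∞ c ∧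
          ∀ n, c =ᶠ[𝓝 (t n)] fun s => y n + (ε n * (s - t n)) • v n := by
  let t : ℕ → ℝ := fun n => (1 / 2) ^ n
  have ht : ∀ n, 0 < t n := fun n => by positivity
  -- The radius `t n / 4` makes the supports disjoint because `t` halves at each step; the bump
  -- equals one within `t n / 8` of `t n`.
  let B : ∀ n, ContDiffBump (t n) := fun n =>
    ⟨t n / 8, t n / 4, by linarith [ht n], by linarith [ht n]⟩
  let φ : ℕ → ℝ → ℝ := fun n => B n
  let ψ : ℕ → ℝ → ℝ := fun n s => φ n s * (s - t n)
  have hφ : ∀ n, ContDiff ℝ ∞ (φ n) := fun n => (B n).contDiff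
  have hψ : ∀ n, ContDiff ℝ ∞ (ψ n) := fun n => (hφ n).mul (contDiff_id.sub contDiff_const)
  have hφc : ∀ n, HasCompactSupport (φ n) := fun n => (B n).hasCompactSupport
  have hψc : ∀ n, HasCompactSupport (ψ n) := fun n => (hφc n).mul_right
  choose P hP using fun n k => exists_bound_iteratedFDeriv (hφ n) (hφc n) k
  choose Q hQ using fun n k => exists_bound_iteratedFDeriv (hψ n) (hψc n) k
  have hP0 : ∀ n k, 0 ≤ P n k := fun n k => (norm_nonneg _).trans (hP n k 0)
  have hQ0 : ∀ n k, 0 ≤ Q n k := fun n k => (norm_nonneg _).trans (hQ n k 0)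
  -- A diagonal choice: the `n`-th scale controls the derivatives of order at most `n`. For fixed
  -- order this covers all but finitely many terms, which suffices for smoothness of the series. The
  -- summand 1 keeps `b n` positive.
  let b : ℕ → ℝ := fun n => 1 + ∑ k ∈ Finset.range (n + 1), (P n k + Q n k)
  have hb0 : ∀ n, 0 < b n := fun n =>
    add_pos_of_pos_of_nonneg one_pos (Finset.sum_nonneg fun k _ => add_nonneg (hP0 n k) (hQ0 n k))
  have hb : ∀ n k, k ≤ n → P n k + Q n k ≤ b n := fun n k hk => by
    have := Finset.single_le_sum (f := fun k => P n k + Q n k)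
      (fun k _ => add_nonneg (hP0 n k) (hQ0 n k)) (Finset.mem_range_succ_iff.2 hk)
    simp only [b]
    linarith
  let ε : ℕ → ℝ := fun n => (1 / 2) ^ n / b n
  have hε : ∀ n, 0 < ε n := fun n => div_pos (by positivity) (hb0 n)
  refine ⟨t, ε, fun n => ⟨(ht n).le, pow_le_one₀ (by norm_num) (by norm_num)⟩, hε, ?_⟩
  intro x y v hy hv
  -- Near `t n` this equals `(y n - x) + (s - t n) • ε n • v n`, so adding `x` gives the prescribed
  -- line.
  let T : ℕ → ℝ → E := fun n s => φ n s • (y n - x) + ψ n s • (ε n • v n)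
  have hT : ∀ n, ContDiff ℝ ∞ (T n) := fun n =>
    ((hφ n).smul contDiff_const).add ((hψ n).smul contDiff_const)
  have hnorm : ∀ (g : ℝ → ℝ) (hg : ContDiff ℝ ∞ g) (w : E) (k : ℕ) (s : ℝ),
      ‖iteratedFDeriv ℝ k (fun s => g s • w) s‖ ≤ ‖iteratedFDeriv ℝ k g s‖ * ‖w‖ := by
    intro g hg w k s
    have h := ((ContinuousLinearMap.id ℝ ℝ).smulRight w).norm_iteratedFDeriv_comp_left
      (f := g) (x := s) (n := k) (N := ∞) hg.contDiffAt (mod_cast le_top)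
    have h2 : ‖(ContinuousLinearMap.id ℝ ℝ).smulRight w‖ ≤ ‖w‖ := by
      rw [ContinuousLinearMap.norm_smulRight_apply]
      simp
    calc _ ≤ ‖(ContinuousLinearMap.id ℝ ℝ).smulRight w‖ * ‖iteratedFDeriv ℝ k g s‖ := h
      _ ≤ ‖w‖ * ‖iteratedFDeriv ℝ k g s‖ := by gcongr
      _ = _ := mul_comm _ _
  have hw : ∀ n, ‖ε n • v n‖ ≤ ε n := fun n => by
    rw [norm_smul, Real.norm_of_nonneg (hε n).le]
    exact mul_le_of_le_one_right (hε n).le (hv n)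
  have hbound : ∀ n k s, k ≤ n → ‖iteratedFDeriv ℝ k (T n) s‖ ≤ (1 / 2) ^ n := by
    intro n k s hk
    have e : iteratedFDeriv ℝ k (T n) s = iteratedFDeriv ℝ k (fun s => φ n s • (y n - x)) s +
        iteratedFDeriv ℝ k (fun s => ψ n s • (ε n • v n)) s :=
      iteratedFDeriv_add_apply
        (((hφ n).smul contDiff_const).of_le (mod_cast le_top)).contDiffAt
        (((hψ n).smul contDiff_const).of_le (mod_cast le_top)).contDiffAt
    rw [e]
    calc _ ≤ ‖iteratedFDeriv ℝ k (φ n) s‖ * ‖y n - x‖ +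
          ‖iteratedFDeriv ℝ k (ψ n) s‖ * ‖ε n • v n‖ :=
          (norm_add_le _ _).trans (add_le_add (hnorm _ (hφ n) _ _ _) (hnorm _ (hψ n) _ _ _))
      _ ≤ P n k * ε n + Q n k * ε n := by
          have := hP0 n k
          have := hQ0 n k
          gcongr
          · exact hP n k s
          · exact hy n
          · exact hQ n k s
          · exact hw n
      _ = (P n k + Q n k) * ε n := by ring
      _ ≤ b n * ε n := by
          have := hε n
          gcongr
          exact hb n k hk
      _ = _ := mul_div_cancel₀ _ (hb0 n).ne'
  refine ⟨fun s => x + ∑' n, T n s, contDiff_const.add (contDiff_tsum_of_eventually hT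
    (v := fun _ n => (1 / 2) ^ n) (fun _ _ => summable_geometric_two) fun k _ => ?_), ?_⟩
  · rw [Nat.cofinite_eq_atTop]
    filter_upwards [eventually_ge_atTop k] with n hn s
    exact hbound n k s hn
  · intro m
    have hm : ∀ᶠ s in 𝓝 (t m), |s - t m| < t m / 8 := by
      have := Metric.ball_mem_nhds (t m) (show 0 < t m / 8 by linarith [ht m])
      filter_upwards [this] with s hs
      simpa [Real.dist_eq] using hs
    filter_upwards [hm] with s hs
    have h1 : φ m s = 1 := (B m).one_of_mem_closedBall (by
      simpa [Real.dist_eq, B] using hs.le)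
    have h0 : ∀ n, n ≠ m → φ n s = 0 := by
      intro n hn
      refine (B n).zero_of_le_dist ?_
      rw [Real.dist_eq]
      change t n / 4 ≤ |s - t n|
      have hhalf : ∀ i j : ℕ, i < j → t j ≤ t i / 2 := by
        intro i j hij
        calc t j ≤ (1 / 2) ^ (i + 1) := pow_le_pow_of_le_one (by norm_num) (by norm_num) hij
          _ = t i / 2 := by simp only [t, pow_succ]; ring
      rw [abs_lt] at hs
      rcases lt_or_gt_of_ne hn with h | h
      · have := hhalf _ _ h
        have := ht n
        exact le_abs.2 (Or.inr (by linarith))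
      · have := hhalf _ _ h
        have := ht m
        exact le_abs.2 (Or.inl (by linarith))
    have hsum : ∑' n, T n s = T m s := tsum_eq_single m fun n hn => by
      simp [T, ψ, h0 n hn]
    change x + ∑' n, T n s = _
    rw [hsum]
    simp only [T, ψ, h1, one_smul, one_mul, smul_smul]
    rw [mul_comm (s - t m)]
    abel

/-- The iterated directional derivatives of a function that is smooth along all smooth curves are
locally bounded. -/
theorem exists_bound_iteratedDeriv_of_curves [CompleteSpace E] {f : E → ℝ}
    (hf : ∀ c : ℝ → E, ContDiff ℝ ∞ c → ContDiff ℝ ∞ (f ∘ c)) (p : ℕ) (x : E) :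
    ∃ δ > 0, ∃ C : ℝ, ∀ y v : E, ‖y - x‖ ≤ δ → ‖v‖ ≤ 1 →
      |iteratedDeriv p (fun s : ℝ => f (y + s • v)) 0| ≤ C := by
  by_contra! hcon
  obtain ⟨t, ε, ht, hε, hc⟩ := exists_special_curve (E := E)
  -- The special curve passes through `y n` with velocity `ε n • v n`, so its `p`-th derivative
  -- picks up the factor `ε n ^ p`. Dividing by it in advance makes the derivative of `f ∘ c` at `t
  -- n` exceed `n`, impossible on the compact interval `[0, 1]`.
  choose y v hy hv hyv using fun n : ℕ => hcon (ε n) (hε n) (n / ε n ^ p)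
  obtain ⟨c, hcs, hct⟩ := hc x y v hy hv
  have hfc := hf c hcs
  obtain ⟨C, hC⟩ := isCompact_Icc.exists_bound_of_continuousOn
    (hfc.continuous_iteratedDeriv p (mod_cast le_top)).continuousOn (s := Set.Icc (0 : ℝ) 1)
  obtain ⟨n, hn⟩ := exists_nat_gt C
  have h1 := hC (t n) (ht n)
  have hline : ContDiff ℝ ∞ fun s : ℝ => f (y n + s • v n) :=
    hf (fun s : ℝ => y n + s • v n) (contDiff_const.add (contDiff_id.smul contDiff_const))
  have e : iteratedDeriv p (f ∘ c) (t n) =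
      ε n ^ p * iteratedDeriv p (fun s : ℝ => f (y n + s • v n)) 0 := by
    have h2 : f ∘ c =ᶠ[𝓝 (t n)] fun s => f (y n + (ε n * (s - t n)) • v n) := by
      filter_upwards [hct n] with s hs
      simp [hs]
    rw [h2.iteratedDeriv_eq p]
    have h3 := congrFun (iteratedDeriv_comp_sub_const p
      (fun s : ℝ => f (y n + (ε n * s) • v n)) (t n)) (t n)
    rw [h3, sub_self]
    have h4 := congrFun (iteratedDeriv_comp_const_mul
      (n := p) (hline.of_le (mod_cast le_top)) (ε n)) 0
    rw [mul_zero] at h4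
    exact h4
  rw [e, Real.norm_eq_abs, abs_mul, abs_of_pos (pow_pos (hε n) p)] at h1
  have h5 := hyv n
  rw [div_lt_iff₀ (pow_pos (hε n) p)] at h5
  linarith

end Boman

/-! ### Boman's theorem. -/

section Boman

variable {E : Type*} [NormedAddCommGroup E] [InnerProductSpace ℝ E] [FiniteDimensional ℝ E]

/-- Compactness makes the local bounds on directional derivatives global. The bounds of order one
give a Lipschitz constant, hence continuity, and the Fourier criterion then applies. -/
theorem contDiff_of_curves_of_hasCompactSupport {f : E → ℝ}
    (hf : ∀ c : ℝ → E, ContDiff ℝ ∞ c → ContDiff ℝ ∞ (f ∘ c)) (hc : HasCompactSupport f) :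
    ContDiff ℝ ∞ f := by
  let _ : MeasurableSpace E := borel E
  have : BorelSpace E := ⟨rfl⟩
  have hline : ∀ x v : E, ContDiff ℝ ∞ fun s : ℝ => f (x + s • v) := fun x v =>
    hf (fun s : ℝ => x + s • v) (contDiff_const.add (contDiff_id.smul contDiff_const))
  have hb : ∀ p, ∃ C : ℝ, ∀ x v : E, ‖v‖ ≤ 1 →
      |iteratedDeriv p (fun s : ℝ => f (x + s • v)) 0| ≤ C := by
    intro p
    choose δ hδ C hC using fun x => exists_bound_iteratedDeriv_of_curves hf p x
    obtain ⟨S, hS⟩ := hc.isCompact.elim_nhds_subcover (fun x => Metric.closedBall x (δ x))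
      fun x _ => Metric.closedBall_mem_nhds x (hδ x)
    -- The sum over the finite subcover dominates every local bound, and off the support all
    -- derivatives vanish.
    refine ⟨∑ x ∈ S, |C x|, fun y v hv => ?_⟩
    by_cases hy : y ∈ tsupport f
    · obtain ⟨x, hx, hxy⟩ := Set.mem_iUnion₂.1 (hS.2 hy)
      refine (hC x y v (by simpa [dist_eq_norm] using hxy) hv).trans ((le_abs_self _).trans ?_)
      exact Finset.single_le_sum (f := fun x => |C x|) (fun _ _ => abs_nonneg _) hx
    · have h1 : (fun s : ℝ => f (y + s • v)) =ᶠ[nhds 0] fun _ => 0 := by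
        have h2 : Continuous fun s : ℝ => y + s • v := by fun_prop
        have h3 := h2.tendsto 0
        rw [zero_smul, add_zero] at h3
        exact h3.eventually (notMem_tsupport_iff_eventuallyEq.1 hy)
      rw [h1.iteratedDeriv_eq p]
      simpa using Finset.sum_nonneg fun x _ => abs_nonneg (C x)
  have hcont : Continuous f := by
    obtain ⟨C, hC⟩ := hb 1
    have hC0 : 0 ≤ C := (abs_nonneg _).trans (hC 0 0 (by simp))
    have hder : ∀ (x v : E) (t : ℝ), ‖v‖ ≤ 1 → ‖deriv (fun s : ℝ => f (x + s • v)) t‖ ≤ C := by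
      intro x v t hv
      have h := hC (x + t • v) v hv
      rw [iteratedDeriv_one] at h
      have h2 := deriv_comp_const_add (fun s : ℝ => f (x + s • v)) t 0
      rw [add_zero] at h2
      rw [← h2, Real.norm_eq_abs]
      simpa only [add_smul, add_assoc] using h
    have hlip : LipschitzWith C.toNNReal f := by
      refine LipschitzWith.of_dist_le_mul fun x y => ?_
      rw [Real.coe_toNNReal _ hC0, dist_eq_norm, dist_eq_norm]
      by_cases hxy : x = y
      · simp [hxy]
      have hne : ‖x - y‖ ≠ 0 := norm_ne_zero_iff.2 (sub_ne_zero.2 hxy)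
      have h := Convex.norm_image_sub_le_of_norm_deriv_le
        (f := fun s : ℝ => f (y + s • ‖x - y‖⁻¹ • (x - y))) (s := Set.univ) (C := C)
        (x := 0) (y := ‖x - y‖)
        (fun s _ => ((hline _ _).differentiable (by simp)) s)
        (fun s _ => hder _ _ _ (by rw [norm_smul, norm_inv, norm_norm, inv_mul_cancel₀ hne]))
        convex_univ trivial trivial
      rw [smul_smul, mul_inv_cancel₀ hne] at h
      simpa using h
    exact hlip.continuous
  refine contDiff_of_bounded_iteratedDeriv (stdOrthonormalBasis ℝ E) f hcont hc
    (fun i x => hline x _) fun i p => ?_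
  obtain ⟨C, hC⟩ := hb p
  exact ⟨C, fun x => hC x _ (by simp)⟩

/-- **Boman's theorem**: a function that is smooth along all smooth curves is smooth. -/
theorem contDiff_of_curves {V : Type*} [NormedAddCommGroup V] [NormedSpace ℝ V]
    [FiniteDimensional ℝ V] {f : V → ℝ}
    (hf : ∀ c : ℝ → V, ContDiff ℝ ∞ c → ContDiff ℝ ∞ (f ∘ c)) : ContDiff ℝ ∞ f := by
  let L := toEuclidean (E := V)
  suffices h : ContDiff ℝ ∞ (f ∘ L.symm) by
    have := h.comp L.contDiff
    simpa [Function.comp_def] using this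
  rw [contDiff_iff_contDiffAt]
  intro x
  -- Multiplying by a bump keeps smoothness along curves, makes the support compact, and does not
  -- change the function near `x`.
  let B : ContDiffBump x := ⟨1, 2, one_pos, one_lt_two⟩
  have h : ContDiff ℝ ∞ fun y => B y * f (L.symm y) :=
    contDiff_of_curves_of_hasCompactSupport
      (fun c hc => (B.contDiff.comp hc).mul (hf (fun t => L.symm (c t)) (L.symm.contDiff.comp hc)))
      B.hasCompactSupport.mul_right
  refine h.contDiffAt.congr_of_eventuallyEq ?_
  filter_upwards [B.eventuallyEq_one] with y hy
  simp [hy]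

end Boman

/-! ### Joint smoothness from `ℓ¹`-combinations, by uniform boundedness. -/

section UniformBoundedness

open Filter Topology

/-- Pairing of `ℓ¹` with a bounded sequence. -/
def pairing (z : ℕ → ℝ) (hz : ∃ C, ∀ m, |z m| ≤ C) : lp (fun _ : ℕ => ℝ) 1 →L[ℝ] ℝ :=
  LinearMap.mkContinuousOfExistsBound
    { toFun := fun a => ∑' m, a m * z m
      map_add' := fun a a' => by
        obtain ⟨C, hC⟩ := hz
        have hs : ∀ a : lp (fun _ : ℕ => ℝ) 1, Summable fun m => a m * z m := fun a =>
          Summable.of_norm_bounded (g := fun m => ‖a m‖ * C)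
            ((by simpa using (memℓp_gen_iff (by simp)).1 (lp.memℓp a) :
              Summable fun m => ‖a m‖).mul_right C)
            fun m => by
              rw [norm_mul]
              exact mul_le_mul_of_nonneg_left (hC m) (norm_nonneg _)
        rw [← (hs a).tsum_add (hs a')]
        simp only [lp.coeFn_add, Pi.add_apply, add_mul]
      map_smul' := fun r a => by
        simp only [lp.coeFn_smul, Pi.smul_apply, smul_eq_mul, mul_assoc, tsum_mul_left,
          RingHom.id_apply] }
    (by
      obtain ⟨C, hC⟩ := hz
      refine ⟨C, fun a => ?_⟩
      have hs : Summable fun m => ‖a m‖ := by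
        simpa using (memℓp_gen_iff (by simp)).1 (lp.memℓp a)
      have hn : ‖a‖ = ∑' m, ‖a m‖ := by
        rw [lp.norm_eq_tsum_rpow (by simp)]
        simp
      rw [hn, ← tsum_mul_left]
      refine tsum_of_norm_bounded (hs.mul_left C).hasSum fun m => ?_
      rw [norm_mul, mul_comm]
      exact mul_le_mul_of_nonneg_right (hC m) (norm_nonneg _))

/-- If all `ℓ¹`-combinations of a pointwise bounded sequence of functions are smooth, then the
derivatives of the functions are uniformly bounded on bounded intervals. -/
theorem exists_bound_of_contDiff_tsum {w : ℕ → ℝ → ℝ} (hw : ∀ t, ∃ C, ∀ m, |w m t| ≤ C)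
    (h : ∀ a : ℕ → ℝ, Summable (fun m => ‖a m‖) → ContDiff ℝ ∞ fun t => ∑' m, a m * w m t)
    (p : ℕ) (T : ℝ) :
    ∃ C, ∀ m, ∀ t ∈ Set.Icc (-T) T, |iteratedDeriv p (w m) t| ≤ C := by
  have h' : ∀ a : lp (fun _ : ℕ => ℝ) 1, ContDiff ℝ ∞ fun t => ∑' m, a m * w m t := fun a =>
    h a (by simpa using (memℓp_gen_iff (by simp)).1 (lp.memℓp a))
  -- The `p`-th derivative at `t` is a continuous functional of the coefficients: inductively it is
  -- a pointwise limit of difference quotients of such functionals, and on the Banach space `ℓ¹`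
  -- such limits are again continuous.
  have hA : ∃ A : ℝ → lp (fun _ : ℕ => ℝ) 1 →L[ℝ] ℝ, ∀ t a,
      A t a = iteratedDeriv p (fun t => ∑' m, a m * w m t) t := by
    induction p with
    | zero => exact ⟨fun t => pairing (fun m => w m t) (hw t), fun t a => by
        rw [iteratedDeriv_zero]
        rfl⟩
    | succ p ih =>
      obtain ⟨A, hA⟩ := ih
      have hlim : ∀ t, Tendsto (fun (n : ℕ) (a : lp (fun _ : ℕ => ℝ) 1) =>
          (((1 : ℝ) / (n + 1))⁻¹ • (A (t + (1 : ℝ) / (n + 1)) - A t)) a) atTop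
          (𝓝 fun a => iteratedDeriv (p + 1) (fun t => ∑' m, a m * w m t) t) := by
        intro t
        rw [tendsto_pi_nhds]
        intro a
        have h1 := (hasDerivAt_iteratedDeriv (h' a) p t).tendsto_slope_zero_right
        have h2 : Tendsto (fun n : ℕ => (1 : ℝ) / (n + 1)) atTop (𝓝[>] 0) :=
          tendsto_nhdsWithin_iff.2 ⟨tendsto_one_div_add_atTop_nhds_zero_nat,
            Eventually.of_forall fun n => by
              simp only [Set.mem_Ioi]
              positivity⟩
        refine (h1.comp h2).congr fun n => ?_
        simp only [Function.comp_apply, smul_apply, sub_apply, hA]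
      exact ⟨fun t => continuousLinearMapOfTendsto _ (hlim t), fun t a => rfl⟩
  obtain ⟨A, hA⟩ := hA
  -- For fixed coefficients the derivative is continuous in `t`, hence bounded on the interval. The
  -- resulting uniform norm bound is then tested on unit vectors.
  obtain ⟨C, hC⟩ := banach_steinhaus (g := fun t : Set.Icc (-T) T => A t) (fun a => by
    obtain ⟨C, hC⟩ := isCompact_Icc.exists_bound_of_continuousOn (s := Set.Icc (-T) T)
      ((h' a).continuous_iteratedDeriv p (mod_cast le_top)).continuousOn
    exact ⟨C, fun t => by
      rw [hA]
      exact hC t t.2⟩)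
  refine ⟨C, fun m t ht => ?_⟩
  have h1 : (fun t => ∑' k, (lp.single 1 m (1 : ℝ) : lp (fun _ : ℕ => ℝ) 1) k * w k t) = w m := by
    funext t
    rw [tsum_eq_single m fun k hk => by simp [lp.single_apply, hk]]
    simp
  have h2 := (A t).le_opNorm (lp.single 1 m (1 : ℝ))
  rw [hA, h1, lp.norm_single (by simp), norm_one, mul_one] at h2
  exact h2.trans (hC ⟨t, ht⟩)

/-- A compactly supported function of two variables is smooth if it is smooth in the second
variable and all `ℓ¹`-combinations of values of its derivatives in the second variable depend
smoothly on the first. -/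
theorem contDiff_of_contDiff_tsum {U : ℝ → ℝ → ℝ} {r : ℝ}
    (hr : ∀ t s, r ≤ |t| ∨ r ≤ |s| → U t s = 0) (hU : ∀ t, ContDiff ℝ ∞ (U t))
    (h : ∀ (q : ℕ) (s a : ℕ → ℝ), Summable (fun m => ‖a m‖) →
      ContDiff ℝ ∞ fun t => ∑' m, a m * iteratedDeriv q (U t) (s m)) :
    ContDiff ℝ ∞ fun z : ℝ × ℝ => U z.1 z.2 := by
  have hUc : ∀ t, HasCompactSupport (U t) := fun t =>
    HasCompactSupport.intro (isCompact_Icc (a := -r) (b := r)) fun s hs => hr t s (Or.inr (by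
      by_contra hcon
      rw [not_le, abs_lt] at hcon
      exact hs ⟨hcon.1.le, hcon.2.le⟩))
  have hB : ∀ p q, ∃ C, ∀ t s, |iteratedDeriv p (fun t => iteratedDeriv q (U t) s) t| ≤ C := by
    intro p q
    by_contra! hcon
    -- Points of blow-up supply the sequence `s` at which the `ℓ¹`-combinations are taken.
    choose t s hts using fun m : ℕ => hcon m
    obtain ⟨C, hC⟩ := exists_bound_of_contDiff_tsum (w := fun m t => iteratedDeriv q (U t) (s m))
      (fun t => by
        obtain ⟨C, hC⟩ := exists_bound_iteratedFDeriv (hU t) (hUc t) q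
        refine ⟨C, fun m => ?_⟩
        rw [← Real.norm_eq_abs, ← norm_iteratedFDeriv_eq_norm_iteratedDeriv]
        exact hC _) (h q s) p r
    obtain ⟨m, hm⟩ := exists_nat_gt C
    -- The bound from `exists_bound_of_contDiff_tsum` holds on `[-r, r]` only; beyond it `U`
    -- vanishes locally in `t`, so no blow-up occurs there.
    have hmt : ¬ r < |t m| := by
      intro hlt
      have h1 : (fun t => iteratedDeriv q (U t) (s m)) =ᶠ[𝓝 (t m)] fun _ => 0 := by
        filter_upwards [(continuous_abs.tendsto (t m)).eventually (lt_mem_nhds hlt)] with t' ht'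
        have : U t' = fun _ => 0 := funext fun s => hr t' s (Or.inl (le_of_lt ht'))
        rw [this]
        simp
      have h2 := hts m
      rw [h1.iteratedDeriv_eq p] at h2
      simp at h2
      exact absurd h2 (not_lt.2 (Nat.cast_nonneg m))
    have h3 := hC m (t m) (abs_le.1 (not_lt.1 hmt))
    linarith [hts m]
  have hT : ∀ s, ContDiff ℝ ∞ fun t => U t s := by
    intro s
    -- A unit coefficient sequence recovers the value at a single point.
    have h1 := h 0 (fun _ => s) (Pi.single 0 1)
      (summable_of_ne_finset_zero (s := {0}) fun m hm => by
      simp at hm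
      simp [hm])
    convert! h1 using 2 with t
    rw [tsum_eq_single 0 fun k hk => by simp [hk]]
    simp
  have hcont : Continuous fun z : ℝ × ℝ => U z.1 z.2 := by
    obtain ⟨C₁, h1⟩ := hB 1 0
    obtain ⟨C₂, h2⟩ := hB 0 1
    simp only [iteratedDeriv_zero, iteratedDeriv_one] at h1 h2
    have hb : ∀ (g : ℝ → ℝ) (C : ℝ), ContDiff ℝ ∞ g → (∀ t, |deriv g t| ≤ C) →
        LipschitzWith C.toNNReal g := fun g C hg hC =>
      lipschitzWith_of_nnnorm_deriv_le (hg.differentiable (by simp)) fun t => by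
        rw [← NNReal.coe_le_coe, coe_nnnorm, Real.norm_eq_abs,
          Real.coe_toNNReal _ ((abs_nonneg _).trans (hC t))]
        exact hC t
    exact (LipschitzWith.uncurry (f := U) (fun s => hb _ C₁ (hT s) fun t => h1 t s)
      (fun t => hb _ C₂ (hU t) fun s => h2 t s)).continuous
  let f : EuclideanSpace ℝ (Fin 2) → ℝ := fun z => U (z 0) (z 1)
  have hf : ContDiff ℝ ∞ f := by
    refine contDiff_of_bounded_iteratedDeriv (EuclideanSpace.basisFun (Fin 2) ℝ) f
      (hcont.comp (by fun_prop : Continuous fun z : EuclideanSpace ℝ (Fin 2) => (z 0, z 1)))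
      (HasCompactSupport.intro (isCompact_closedBall 0 (2 * |r|)) fun z hz => hr _ _ ?_) ?_ ?_
    · by_contra! hcon
      apply hz
      rw [mem_closedBall_zero_iff, EuclideanSpace.norm_eq, Real.sqrt_le_left (by positivity),
        Fin.sum_univ_two]
      simp only [Real.norm_eq_abs]
      nlinarith [abs_nonneg (z 0), abs_nonneg (z 1), le_abs_self r]
    · intro i x
      fin_cases i
      · simpa [f, Function.comp_def] using (hT (x 1)).comp
          (contDiff_const.add contDiff_id : ContDiff ℝ ∞ fun s => x 0 + s)
      · simpa [f, Function.comp_def] using (hU (x 0)).comp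
          (contDiff_const.add contDiff_id : ContDiff ℝ ∞ fun s => x 1 + s)
    · intro i p
      fin_cases i
      · obtain ⟨C, hC⟩ := hB p 0
        refine ⟨C, fun x => ?_⟩
        have := hC (x 0) (x 1)
        have e := congrFun (iteratedDeriv_comp_const_add p (fun t => U t (x 1)) (x 0)) 0
        simp only [iteratedDeriv_zero] at this
        simp only [add_zero] at e
        simpa [f, e] using this
      · obtain ⟨C, hC⟩ := hB 0 p
        refine ⟨C, fun x => ?_⟩
        have := hC (x 0) (x 1)
        have e := congrFun (iteratedDeriv_comp_const_add p (fun t => U (x 0) t) (x 1)) 0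
        simp only [iteratedDeriv_zero] at this
        simp only [add_zero] at e
        simpa [f, e] using this
  have hL : ContDiff ℝ ∞ fun z : ℝ × ℝ =>
      (WithLp.toLp 2 ![z.1, z.2] : EuclideanSpace ℝ (Fin 2)) := by
    rw [contDiff_euclidean]
    intro i
    fin_cases i
    · exact contDiff_fst
    · exact contDiff_snd
  exact hf.comp hL

end UniformBoundedness

/-! ### Smooth dependence of `ℓ¹`-combinations on a parameter. -/

section Tsum

open Filter Topology

/-- A directional derivative of a smooth compactly supported function is again one. In particular
derivatives along all parallel lines are bounded by one constant, as the Weierstrass test requires.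
-/
theorem exists_iteratedDeriv_line {E : Type*} [NormedAddCommGroup E] [NormedSpace ℝ E] {W : E → ℝ}
    (hW : ContDiff ℝ ∞ W) (hc : HasCompactSupport W) (v : E) (q : ℕ) :
    ∃ W' : E → ℝ, ContDiff ℝ ∞ W' ∧ HasCompactSupport W' ∧
      ∀ x s, iteratedDeriv q (fun s : ℝ => W (x + s • v)) s = W' (x + s • v) := by
  induction q with
  | zero => exact ⟨W, hW, hc, fun x s => by simp⟩
  | succ q ih =>
    obtain ⟨W', h1, h2, h3⟩ := ih
    refine ⟨fun z => fderiv ℝ W' z v, (h1.fderiv_right (m := ∞) (by simp)).clm_apply contDiff_const,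
      h2.fderiv_apply ℝ v, fun x s => ?_⟩
    rw [iteratedDeriv_succ, funext (h3 x)]
    have h4 : HasDerivAt (fun s : ℝ => x + s • v) v s := by
      simpa using ((hasDerivAt_id s).smul_const v).const_add x
    exact (((h1.differentiable (by simp)) (x + s • v)).hasFDerivAt.comp_hasDerivAt s h4).deriv

/-- An `ℓ¹`-combination of values of derivatives in the second variable of a smooth function
depends smoothly on the first variable. -/
theorem contDiff_tsum_iteratedDeriv {v : ℝ × ℝ → ℝ} (hv : ContDiff ℝ ∞ v) {b : ℝ → ℝ}
    (hb : ContDiff ℝ ∞ b) (hbc : HasCompactSupport b) (q : ℕ) (s a : ℕ → ℝ)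
    (ha : Summable fun m => ‖a m‖) :
    ContDiff ℝ ∞ fun t => ∑' m, a m * iteratedDeriv q (fun s => b s * v (t, s)) (s m) := by
  rw [contDiff_iff_contDiffAt]
  intro t₀
  -- Smoothness at `t₀` is local, so a cutoff in the first variable may be inserted to make the
  -- support compact.
  let B : ContDiffBump t₀ := ⟨1, 2, one_pos, one_lt_two⟩
  let W : ℝ × ℝ → ℝ := fun z => B z.1 * (b z.2 * v z)
  have hW : ContDiff ℝ ∞ W :=
    (B.contDiff.comp contDiff_fst).mul ((hb.comp contDiff_snd).mul hv)
  have hWc : HasCompactSupport W := by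
    refine HasCompactSupport.intro (B.hasCompactSupport.isCompact.prod hbc.isCompact) fun z hz => ?_
    rw [Set.mem_prod, not_and_or] at hz
    rcases hz with hz | hz
    · simp [W, image_eq_zero_of_notMem_tsupport hz]
    · simp [W, image_eq_zero_of_notMem_tsupport hz]
  obtain ⟨W', h1, h2, h3⟩ := exists_iteratedDeriv_line hW hWc (0, 1) q
  have h4 : ∀ t s, iteratedDeriv q (fun s => W (t, s)) s = W' (t, s) := fun t s => by
    simpa using h3 (t, 0) s
  have key : ContDiff ℝ ∞ fun t => ∑' m, a m * W' (t, s m) := by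
    choose V hV hVc hVe using fun k => exists_iteratedDeriv_line h1 h2 ((1, 0) : ℝ × ℝ) k
    choose C hC using fun k => exists_bound_iteratedFDeriv (hV k) (hVc k) 0
    refine contDiff_tsum (v := fun k m => ‖a m‖ * C k)
      (fun m => contDiff_const.mul (h1.comp (contDiff_id.prodMk contDiff_const)))
      (fun k _ => ha.mul_right _) fun k m t _ => ?_
    rw [norm_iteratedFDeriv_eq_norm_iteratedDeriv, iteratedDeriv_const_mul_field, norm_mul]
    refine mul_le_mul_of_nonneg_left ?_ (norm_nonneg _)
    have h5 := hVe k (0, s m) t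
    simp only [Prod.smul_mk, smul_eq_mul, mul_one, mul_zero, Prod.mk_add_mk, zero_add,
      add_zero] at h5
    simpa [h5] using hC k (t, s m)
  refine key.contDiffAt.congr_of_eventuallyEq ?_
  filter_upwards [B.eventuallyEq_one] with t ht
  refine tsum_congr fun m => ?_
  rw [← h4]
  simp only [W, ht, Pi.one_apply, one_mul]

end Tsum

namespace FrolicherSpace

/-! ### Curves in products and exponentials; smoothness of evaluation. -/

section Curves

theorem contDiff_comp {X : FrolicherSpace} {f : X → ℝ} (hf : f ∈ X.functions) {c : ℝ → X}
    (hc : c ∈ X.curves) : ContDiff ℝ ∞ (f ∘ c) :=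
  (X.mem_functions_iff f).1 hf c hc

theorem comp_mem_curves {X : FrolicherSpace} {c : ℝ → X} (hc : c ∈ X.curves) {σ : ℝ → ℝ}
    (hσ : ContDiff ℝ ∞ σ) : (fun t => c (σ t)) ∈ X.curves :=
  (X.mem_curves_iff _).2 fun _ hf => (contDiff_comp hf hc).comp hσ

theorem const_mem_curves {X : FrolicherSpace} (x : X) : (fun _ => x) ∈ X.curves :=
  (X.mem_curves_iff _).2 fun _ _ => contDiff_const

theorem mem_curves_R {c : ℝ → R} : c ∈ R.curves ↔ ContDiff ℝ ∞ fun t => toReal (c t) :=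
  by
  simp only [R, ofFunctions, Set.mem_singleton_iff, forall_eq]
  rfl

theorem mem_curves_prod {X Y : FrolicherSpace} {c : ℝ → prod X Y} :
    c ∈ (prod X Y).curves ↔
      (fun t => (c t).1) ∈ X.curves ∧ (fun t => (c t).2) ∈ Y.curves := by
  refine ⟨fun h => ⟨(X.mem_curves_iff _).2 fun f hf => h _ (Or.inl ⟨f, hf, rfl⟩),
    (Y.mem_curves_iff _).2 fun f hf => h _ (Or.inr ⟨f, hf, rfl⟩)⟩, ?_⟩
  rintro ⟨h1, h2⟩ _ (⟨f, hf, rfl⟩ | ⟨f, hf, rfl⟩)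
  · exact contDiff_comp hf h1
  · exact contDiff_comp hf h2

/-- A curve in `X^Y` is generating as soon as its value along each pair of a reparametrization and
a curve in `Y` is a curve. -/
theorem mem_curves_mapSpace_of {X Y : FrolicherSpace} {c : ℝ → mapSpace Y X}
    (h : ∀ (τ : ℝ → ℝ) (η : ℝ → Y), ContDiff ℝ ∞ τ → η ∈ Y.curves →
      (fun t => ev (c (τ t)) (η t)) ∈ X.curves) : c ∈ (mapSpace Y X).curves :=
  fun _ hf => hf c fun d hd =>
    h (fun t => toReal (d t).1) (fun t => (d t).2) (mem_curves_R.1 (mem_curves_prod.1 hd).1)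
      (mem_curves_prod.1 hd).2

/-- Evaluation `X^Y × Y → X` is smooth. -/
theorem ev_mem_curves {X Y : FrolicherSpace} {c : ℝ → mapSpace Y X}
    (hc : c ∈ (mapSpace Y X).curves) {η : ℝ → Y} (hη : η ∈ Y.curves) :
    (fun t => ev (c t) (η t)) ∈ X.curves := by
  refine (X.mem_curves_iff _).2 fun φ hφ => ?_
  -- The curve and the argument get independent parameters; restricting to the diagonal recovers the
  -- claim.
  suffices h : ContDiff ℝ ∞ fun z : ℝ × ℝ => φ (ev (c z.1) (η z.2)) from
    h.comp (contDiff_id.prodMk contDiff_id)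
  have hcη : ∀ k : mapSpace Y X, ContDiff ℝ ∞ fun s => φ (ev k (η s)) := fun k =>
    contDiff_comp hφ (Hom.smooth k η hη)
  rw [contDiff_iff_contDiffAt]
  rintro ⟨t₀, s₀⟩
  let B₁ : ContDiffBump t₀ := ⟨1, 2, one_pos, one_lt_two⟩
  let B₂ : ContDiffBump s₀ := ⟨1, 2, one_pos, one_lt_two⟩
  have hU : ContDiff ℝ ∞ fun z : ℝ × ℝ => B₁ z.1 * (B₂ z.2 * φ (ev (c z.1) (η z.2))) := by
    refine contDiff_of_contDiff_tsum (U := fun t s => B₁ t * (B₂ s * φ (ev (c t) (η s))))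
      -- Outside this range `t` or `s` is at distance at least 2, the outer radius, from the centre
      -- of its bump.
      (r := |t₀| + |s₀| + 2) ?_ (fun t => contDiff_const.mul (B₂.contDiff.mul (hcη _))) ?_
    · rintro t s (h | h)
      · rw [B₁.zero_of_le_dist, zero_mul]
        rw [Real.dist_eq]
        change 2 ≤ _
        linarith [abs_sub_abs_le_abs_sub t t₀, abs_nonneg s₀]
      · rw [B₂.zero_of_le_dist, zero_mul, mul_zero]
        rw [Real.dist_eq]
        change 2 ≤ _
        linarith [abs_sub_abs_le_abs_sub s s₀, abs_nonneg t₀]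
    · intro q s a ha
      -- The test functional. Along a generating curve `e` the map `(t, s) ↦ φ (e t (η s))` is
      -- smooth along plane curves, hence smooth by Boman, so `F ∘ e` is smooth and `F` is a
      -- function of `X^Y`. It may therefore be applied to the arbitrary curve `c`.
      let F : mapSpace Y X → ℝ := fun k =>
        ∑' m, a m * iteratedDeriv q (fun s => B₂ s * φ (ev k (η s))) (s m)
      have hF : F ∈ (mapSpace Y X).functions := by
        intro e he
        have hv : ContDiff ℝ ∞ fun z : ℝ × ℝ => φ (ev (e z.1) (η z.2)) := by
          refine contDiff_of_curves fun d hd => contDiff_comp hφ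
            (he (fun t => ((d t).1, η (d t).2)) (mem_curves_prod.2
              ⟨mem_curves_R.2 (ContDiff.fst (f := d) hd),
                comp_mem_curves hη (ContDiff.snd (f := d) hd)⟩))
        exact contDiff_tsum_iteratedDeriv hv B₂.contDiff B₂.hasCompactSupport q s a ha
      have h1 := (B₁.contDiff : ContDiff ℝ ∞ B₁).mul (contDiff_comp hF hc)
      convert! h1 using 2 with t
      simp only [F, Function.comp_apply, iteratedDeriv_const_mul_field]
      rw [← tsum_mul_left]
      refine tsum_congr fun m => ?_
      ring
  refine hU.contDiffAt.congr_of_eventuallyEq ?_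
  have h1 : ∀ᶠ z : ℝ × ℝ in nhds (t₀, s₀), B₁ z.1 = 1 :=
    (continuous_fst.tendsto (t₀, s₀)).eventually B₁.eventuallyEq_one
  have h2 : ∀ᶠ z : ℝ × ℝ in nhds (t₀, s₀), B₂ z.2 = 1 :=
    (continuous_snd.tendsto (t₀, s₀)).eventually B₂.eventuallyEq_one
  filter_upwards [h1, h2] with z hz1 hz2
  rw [hz1, hz2, one_mul, one_mul]

end Curves

end FrolicherSpace

/-! ### Ideals of tensor products -/

namespace Pres

theorem comp_fstMap_mem {P Q : Pres} {u : Cinf P.dim} (hu : u ∈ P.ideal) :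
    u.comp (Cinf.fstMap P.dim Q.dim) ∈ (P.tensor Q).ideal :=
  Ideal.mem_sup_left (Ideal.mem_map_of_mem (Cinf.compHom (Cinf.fstMap P.dim Q.dim)) hu)

theorem comp_sndMap_mem {P Q : Pres} {u : Cinf Q.dim} (hu : u ∈ Q.ideal) :
    u.comp (Cinf.sndMap P.dim Q.dim) ∈ (P.tensor Q).ideal :=
  Ideal.mem_sup_right (Ideal.mem_map_of_mem (Cinf.compHom (Cinf.sndMap P.dim Q.dim)) hu)

/-- The preimage of `K` under composition with `p` is an ideal, so only the two families of
generators need checking. -/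
theorem comp_mem_of_mem_tensor {P Q : Pres} {m : ℕ} {p : Fin (P.dim + Q.dim) → Cinf m}
    {K : Ideal (Cinf m)} (h₁ : ∀ u ∈ P.ideal, u.comp (fun i => p (Fin.castAdd Q.dim i)) ∈ K)
    (h₂ : ∀ u ∈ Q.ideal, u.comp (fun i => p (Fin.natAdd P.dim i)) ∈ K)
    {u : Cinf (P.dim + Q.dim)} (hu : u ∈ (P.tensor Q).ideal) : u.comp p ∈ K := by
  have : (P.tensor Q).ideal ≤ K.comap (Cinf.compHom p) :=
    sup_le (Ideal.map_le_iff_le_comap.2 h₁) (Ideal.map_le_iff_le_comap.2 h₂)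
  exact this hu

end Pres

/-- Composition with a map `p : ℝᵐ → ℝⁿ`, as a linear map `C^∞(ℝⁿ) → C^∞(ℝᵐ)`. -/
def Cinf.compLinear {n m : ℕ} (p : Fin n → Cinf m) : Cinf n →ₗ[ℝ] Cinf m where
  toFun u := u.comp p
  map_add' _ _ := rfl
  map_smul' _ _ := rfl

/-- Index maps built with `Fin.addCases` simplify only up to a proved equality; this transports
ideal membership across it. -/
theorem Cinf.comp_coord_mem {n m : ℕ} {σ τ : Fin n → Fin m} (h : ∀ i, σ i = τ i)
    {I : Ideal (Cinf m)} {u : Cinf n} (hu : u.comp (fun i => Cinf.coord (τ i)) ∈ I) :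
    u.comp (fun i => Cinf.coord (σ i)) ∈ I := by
  rw [funext h]
  exact hu

/-- The Weil algebra `ℝ = C^∞(ℝ⁰)`. -/
def WeilAlgebra.real : WeilAlgebra where
  dim := 0
  ideal := ⊥
  le_maxIdeal := bot_le
  -- On the one-point space `ℝ⁰` a function vanishing at the origin is already zero.
  exists_pow_le := ⟨1, by
    rw [pow_one]
    intro f hf
    refine Subtype.ext (funext fun x => ?_)
    rw [Subsingleton.elim x 0]
    exact hf⟩

/-- The substitution of coordinates along `σ` induces a map `W → V` of Weil algebras. -/
def WeilAlgebra.Subst (W V : WeilAlgebra) (σ : Fin W.dim → Fin V.dim) : Prop :=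
  ∀ u ∈ W.ideal, u.comp (fun i => Cinf.coord (σ i)) ∈ V.ideal

namespace FrolicherSpace

/-! ### Diffeomorphisms -/

/-- An isomorphism of Frölicher spaces. -/
structure Diffeo (X Y : FrolicherSpace) where
  hom : Hom X Y
  inv : Hom Y X
  left_inv : ∀ x, inv (hom x) = x
  right_inv : ∀ y, hom (inv y) = y

namespace Diffeo

variable {X Y Z : FrolicherSpace}

def symm (e : Diffeo X Y) : Diffeo Y X := ⟨e.inv, e.hom, e.right_inv, e.left_inv⟩

def trans (e : Diffeo X Y) (e' : Diffeo Y Z) : Diffeo X Z :=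
  ⟨e'.hom.comp e.hom, e.inv.comp e'.inv,
    fun x => (congrArg e.inv.toFun (e'.left_inv (e.hom x))).trans (e.left_inv x),
    fun z => (congrArg e'.hom.toFun (e.right_inv (e'.inv z))).trans (e'.right_inv z)⟩

def ofIso (e : X ≅ Y) : Diffeo X Y :=
  ⟨e.hom, e.inv, fun x => congrFun (congrArg Hom.toFun e.hom_inv_id) x,
    fun y => congrFun (congrArg Hom.toFun e.inv_hom_id) y⟩

def toIso (e : Diffeo X Y) : X ≅ Y :=
  ⟨e.hom, e.inv, Hom.ext (funext e.left_inv), Hom.ext (funext e.right_inv)⟩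

/-- The isomorphism `e ⊗ W`. -/
def prol (e : Diffeo X Y) (W : WeilAlgebra) : Diffeo (X.prol W) (Y.prol W) where
  hom := prolMap e.hom W
  inv := prolMap e.inv W
  left_inv q := by
    refine Quotient.inductionOn (motive := fun q => prolMap e.inv W (prolMap e.hom W q) = q) q ?_
    intro f
    exact congrArg (cls W) (Hom.ext (funext fun x => e.left_inv (f x)))
  right_inv q := by
    refine Quotient.inductionOn (motive := fun q => prolMap e.hom W (prolMap e.inv W q) = q) q ?_
    intro f
    exact congrArg (cls W) (Hom.ext (funext fun x => e.right_inv (f x)))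

/-- The isomorphism `e^Y`. -/
def mapSpace (Y : FrolicherSpace) {X X' : FrolicherSpace} (e : Diffeo X X') :
    Diffeo (mapSpace Y X) (mapSpace Y X') where
  hom := mapSpaceMap Y e.hom
  inv := mapSpaceMap Y e.inv
  left_inv f := Hom.ext (funext fun y => e.left_inv (ev f y))
  right_inv f := Hom.ext (funext fun y => e.right_inv (ev f y))

end Diffeo

theorem exists_cls {X : FrolicherSpace} {W : WeilAlgebra} (q : prol X W) :
    ∃ f : Hom (Rn W.dim) X, cls W f = q :=
  Quotient.exists_rep q

/-! ### Exponentials -/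

theorem mapSpace_ext {X Y : FrolicherSpace} {f g : mapSpace Y X} (h : ∀ y, ev f y = ev g y) :
    f = g :=
  Hom.ext (funext h)

/-- The smooth map `A → X^Y` given by a smooth map `A × Y → X`. -/
def curry {A Y X : FrolicherSpace} (k : A → Y → X)
    (h : ∀ c ∈ A.curves, ∀ η ∈ Y.curves, (fun t => k (c t) (η t)) ∈ X.curves) :
    Hom A (mapSpace Y X) where
  toFun a := (⟨k a, fun η hη => h _ (const_mem_curves a) η hη⟩ : Hom Y X)
  smooth _ hc := mem_curves_mapSpace_of fun _ η hτ hη => h _ (comp_mem_curves hc hτ) η hη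

/-- The uncurrying half of the exponential law, the converse of `curry`; it rests on smooth
evaluation. -/
theorem mem_curves_of_hom {A Y X : FrolicherSpace} (k : Hom A (mapSpace Y X)) {c : ℝ → A}
    (hc : c ∈ A.curves) {η : ℝ → Y} (hη : η ∈ Y.curves) :
    (fun t => ev (k (c t)) (η t)) ∈ X.curves :=
  ev_mem_curves (k.smooth c hc) hη

/-- The partial map `k(·)(y)` of a smooth map `k : A → X^Y`. -/
def evalAt {A Y X : FrolicherSpace} (k : Hom A (mapSpace Y X)) (y : Y) : Hom A X :=
  ⟨fun a => ev (k a) y, fun _ hc => mem_curves_of_hom k hc (const_mem_curves y)⟩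

/-- The isomorphism `X^(Z × Y) = (X^Z)^Y`. -/
def curryDiffeo (Z Y X : FrolicherSpace) :
    Diffeo (mapSpace (prod Z Y) X) (mapSpace Y (mapSpace Z X)) where
  hom := curry
    (fun k => (curry (fun y z => ev k (z, y)) fun _ hc _ hη =>
      Hom.smooth k _ (mem_curves_prod.2 ⟨hη, hc⟩) : Hom Y (mapSpace Z X)).toFun)
    fun _ hc _ hη => mem_curves_mapSpace_of fun _ _ hτ hζ =>
      ev_mem_curves (comp_mem_curves hc hτ)
        (mem_curves_prod.2 ⟨hζ, comp_mem_curves hη hτ⟩ :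
          _ ∈ (prod Z Y).curves)
  inv := curry (fun k q => ev (ev k q.2) q.1) fun _ hc _ hη =>
    ev_mem_curves (ev_mem_curves hc (mem_curves_prod.1 hη).2) (mem_curves_prod.1 hη).1
  left_inv _ := rfl
  right_inv _ := rfl

/-- The one-point space. -/
def point : FrolicherSpace := ofFunctions PUnit ∅

theorem mem_curves_point (c : ℝ → point) : c ∈ point.curves := fun _ h => h.elim

/-- The isomorphism `X = X^pt`. -/
def pointDiffeo (X : FrolicherSpace) : Diffeo X (mapSpace point X) where
  hom := curry (fun x _ => x) fun _ hc _ _ => hc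
  inv := ⟨fun k => ev k PUnit.unit, fun _ hc => ev_mem_curves hc (mem_curves_point _)⟩
  left_inv _ := rfl
  right_inv _ := rfl

/-! ### Substitution of coordinates in Weil prolongations -/

/-- The substitution of coordinates along `σ`, as a smooth map `ℝᵇ → ℝᵃ`. -/
def substRn {a b : ℕ} (σ : Fin a → Fin b) : Hom (Rn b) (Rn a) :=
  ⟨fun (x : Fin b → ℝ) => (fun i => x (σ i) : Fin a → ℝ), fun _ hc =>
    mem_curves_Rn.2 fun i => mem_curves_Rn.1 hc (σ i)⟩

/-- The map `X ⊗ W → X ⊗ V` for a substitution of coordinates, on underlying sets. -/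
def prolSetSubst (X : FrolicherSpace) {W V : WeilAlgebra} (σ : Fin W.dim → Fin V.dim)
    (hσ : W.Subst V σ) : ProlSet X W → ProlSet X V :=
  Quotient.map (fun f => f.comp (substRn σ)) fun _ _ h => ⟨h.1, fun χ => by
    obtain ⟨u, hu, hux⟩ := h.2 χ
    exact ⟨_, hσ u hu, fun x => hux fun i => x (σ i)⟩⟩

/-- Substitution is linear and respects the ideals, so functionals on `V` pull back to functionals
on `W`. -/
theorem prolSetSubst_mem_curves {W V : WeilAlgebra} (σ : Fin W.dim → Fin V.dim)
    (hσ : W.Subst V σ) {c : ℝ → ProlSet R W} (hc : c ∈ (realProl W).curves) :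
    prolSetSubst R σ hσ ∘ c ∈ (realProl V).curves := by
  rintro v ⟨l, hl, hv⟩
  exact hc (v ∘ prolSetSubst R σ hσ)
    ⟨l.comp (Cinf.compLinear fun i => Cinf.coord (σ i)), fun u hu => hl _ (hσ u hu),
      fun u => hv (u.comp fun i => Cinf.coord (σ i))⟩

/-- The smooth map `X ⊗ W → X ⊗ V` for a substitution of coordinates. -/
def prolSubst (X : FrolicherSpace) {W V : WeilAlgebra} (σ : Fin W.dim → Fin V.dim)
    (hσ : W.Subst V σ) : Hom (prol X W) (prol X V) where
  toFun := prolSetSubst X σ hσ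
  smooth c hc := by
    rintro _ ⟨χ, v, hv, rfl⟩
    have h : prolSetMap χ W ∘ c ∈ (realProl W).curves :=
      ((realProl W).mem_curves_iff _).2 fun f hf => hc _ ⟨χ, f, hf, rfl⟩
    have h2 := contDiff_comp hv (prolSetSubst_mem_curves σ hσ h)
    convert! h2 using 1
    funext t
    refine Quotient.inductionOn (motive := fun q => v (prolSetMap χ V (prolSetSubst X σ hσ q)) =
      v (prolSetSubst R σ hσ (prolSetMap χ W q))) (c t) ?_
    intro f
    rfl

theorem prolSubst_cls {X : FrolicherSpace} {W V : WeilAlgebra} (σ : Fin W.dim → Fin V.dim)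
    (hσ : W.Subst V σ) (f : Hom (Rn W.dim) X) :
    prolSubst X σ hσ (cls W f) = cls V (f.comp (substRn σ)) := rfl

/-- The isomorphism `X ⊗ W = X ⊗ V` for a permutation of coordinates. -/
def substDiffeo (X : FrolicherSpace) {W V : WeilAlgebra} (σ : Fin W.dim → Fin V.dim)
    (hσ : W.Subst V σ) (τ : Fin V.dim → Fin W.dim) (hτ : V.Subst W τ)
    (hστ : ∀ i, τ (σ i) = i) (hτσ : ∀ i, σ (τ i) = i) : Diffeo (prol X W) (prol X V) where
  hom := prolSubst X σ hσ
  inv := prolSubst X τ hτ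
  left_inv q := by
    obtain ⟨f, rfl⟩ := exists_cls q
    rw [prolSubst_cls, prolSubst_cls]
    refine congrArg (cls W) (Hom.ext (funext fun x => congrArg f.toFun ?_))
    exact funext fun i => congrArg x (hστ i)
  right_inv q := by
    obtain ⟨f, rfl⟩ := exists_cls q
    rw [prolSubst_cls, prolSubst_cls]
    refine congrArg (cls V) (Hom.ext (funext fun x => congrArg f.toFun ?_))
    exact funext fun i => congrArg x (hτσ i)

/-- The isomorphism `X ⊗ (ℝ ⊗_∞ W) = X ⊗ W`. -/
def leftUnitor (X : FrolicherSpace) (W : WeilAlgebra) :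
    Diffeo (prol X (WeilAlgebra.real.tensor W)) (prol X W) :=
  substDiffeo X (W := WeilAlgebra.real.tensor W) (V := W)
    (Fin.addCases (m := 0) (n := W.dim) (fun i => i.elim0) id)
    (fun u hu => Pres.comp_mem_of_mem_tensor (P := WeilAlgebra.real.toPres) (Q := W.toPres)
      (fun v hv => by
        rw [show v = 0 from hv]
        exact W.ideal.zero_mem)
      (fun v hv => Cinf.comp_coord_mem (τ := id)
        (fun i => Fin.addCases_right (m := 0) i) hv) hu)
    (Fin.natAdd 0) (fun u hu => Pres.comp_sndMap_mem (P := WeilAlgebra.real.toPres) hu)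
    (fun i => Fin.addCases (m := 0) (n := W.dim)
      (motive := fun i => Fin.natAdd 0 (Fin.addCases (m := 0) (n := W.dim)
        (motive := fun _ => Fin W.dim) (fun i => i.elim0) id i) = i)
      (fun j => j.elim0) (fun j => by rw [Fin.addCases_right]; rfl) i)
    (fun i => Fin.addCases_right (m := 0) i)

/-- The identification of the coordinates of `ℝ⁽ᵃ⁺ᵇ⁾⁺ᶜ` and of `ℝᵃ⁺⁽ᵇ⁺ᶜ⁾`. -/
def assocFin (a b c : ℕ) : Fin (a + b + c) → Fin (a + (b + c)) :=
  Fin.addCases (Fin.addCases (Fin.castAdd (b + c)) fun i => Fin.natAdd a (Fin.castAdd c i))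
    fun i => Fin.natAdd a (Fin.natAdd b i)

def assocFinInv (a b c : ℕ) : Fin (a + (b + c)) → Fin (a + b + c) :=
  Fin.addCases (fun i => Fin.castAdd c (Fin.castAdd b i))
    (Fin.addCases (fun i => Fin.castAdd c (Fin.natAdd a i)) (Fin.natAdd (a + b)))

section

variable {a b c : ℕ}

theorem assocFin_castAdd_castAdd (i : Fin a) :
    assocFin a b c (Fin.castAdd c (Fin.castAdd b i)) = Fin.castAdd (b + c) i := by
  simp [assocFin]

theorem assocFin_castAdd_natAdd (i : Fin b) :
    assocFin a b c (Fin.castAdd c (Fin.natAdd a i)) = Fin.natAdd a (Fin.castAdd c i) := by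
  simp [assocFin]

theorem assocFin_natAdd (i : Fin c) :
    assocFin a b c (Fin.natAdd (a + b) i) = Fin.natAdd a (Fin.natAdd b i) := by
  simp [assocFin]

theorem assocFinInv_castAdd (i : Fin a) :
    assocFinInv a b c (Fin.castAdd (b + c) i) = Fin.castAdd c (Fin.castAdd b i) := by
  simp [assocFinInv]

theorem assocFinInv_natAdd_castAdd (i : Fin b) :
    assocFinInv a b c (Fin.natAdd a (Fin.castAdd c i)) = Fin.castAdd c (Fin.natAdd a i) := by
  simp [assocFinInv]

theorem assocFinInv_natAdd_natAdd (i : Fin c) :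
    assocFinInv a b c (Fin.natAdd a (Fin.natAdd b i)) = Fin.natAdd (a + b) i := by
  simp [assocFinInv]

theorem assocFinInv_assocFin (i : Fin (a + b + c)) : assocFinInv a b c (assocFin a b c i) = i := by
  refine Fin.addCases (fun i => ?_) (fun i => ?_) i
  · refine Fin.addCases (fun i => ?_) (fun i => ?_) i <;> simp [assocFin, assocFinInv]
  · simp [assocFin, assocFinInv]

theorem assocFin_assocFinInv (i : Fin (a + (b + c))) :
    assocFin a b c (assocFinInv a b c i) = i := by
  refine Fin.addCases (fun i => ?_) (fun i => ?_) i
  · simp [assocFin, assocFinInv]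
  · refine Fin.addCases (fun i => ?_) (fun i => ?_) i <;> simp [assocFin, assocFinInv]

end

/-- The isomorphism `X ⊗ ((W₁ ⊗_∞ W₂) ⊗_∞ W₃) = X ⊗ (W₁ ⊗_∞ (W₂ ⊗_∞ W₃))`. -/
def associator (X : FrolicherSpace) (W₁ W₂ W₃ : WeilAlgebra) :
    Diffeo (prol X ((W₁.tensor W₂).tensor W₃)) (prol X (W₁.tensor (W₂.tensor W₃))) :=
  substDiffeo X (W := (W₁.tensor W₂).tensor W₃) (V := W₁.tensor (W₂.tensor W₃))
    (assocFin W₁.dim W₂.dim W₃.dim)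
    (fun _ hu => Pres.comp_mem_of_mem_tensor (P := (W₁.tensor W₂).toPres) (Q := W₃.toPres)
      (fun _ hv => Pres.comp_mem_of_mem_tensor (P := W₁.toPres) (Q := W₂.toPres)
        (fun _ hw => Cinf.comp_coord_mem assocFin_castAdd_castAdd
          (Pres.comp_fstMap_mem (P := W₁.toPres) (Q := (W₂.tensor W₃).toPres) hw))
        (fun _ hw => Cinf.comp_coord_mem assocFin_castAdd_natAdd
          (Pres.comp_sndMap_mem (P := W₁.toPres) (Q := (W₂.tensor W₃).toPres)
            (Pres.comp_fstMap_mem (P := W₂.toPres) (Q := W₃.toPres) hw))) hv)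
      (fun _ hv => Cinf.comp_coord_mem assocFin_natAdd
        (Pres.comp_sndMap_mem (P := W₁.toPres) (Q := (W₂.tensor W₃).toPres)
          (Pres.comp_sndMap_mem (P := W₂.toPres) (Q := W₃.toPres) hv))) hu)
    (assocFinInv W₁.dim W₂.dim W₃.dim)
    (fun _ hu => Pres.comp_mem_of_mem_tensor (P := W₁.toPres) (Q := (W₂.tensor W₃).toPres)
      (fun _ hv => Cinf.comp_coord_mem assocFinInv_castAdd
        (Pres.comp_fstMap_mem (P := (W₁.tensor W₂).toPres) (Q := W₃.toPres)
          (Pres.comp_fstMap_mem (P := W₁.toPres) (Q := W₂.toPres) hv)))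
      (fun _ hv => Pres.comp_mem_of_mem_tensor (P := W₂.toPres) (Q := W₃.toPres)
        (fun _ hw => Cinf.comp_coord_mem assocFinInv_natAdd_castAdd
          (Pres.comp_fstMap_mem (P := (W₁.tensor W₂).toPres) (Q := W₃.toPres)
            (Pres.comp_sndMap_mem (P := W₁.toPres) (Q := W₂.toPres) hw)))
        (fun _ hw => Cinf.comp_coord_mem assocFinInv_natAdd_natAdd
          (Pres.comp_sndMap_mem (P := (W₁.tensor W₂).toPres) (Q := W₃.toPres) hw)) hv) hu)
    assocFinInv_assocFin assocFin_assocFinInv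

/-! ### The Weil prolongation for the trivial Weil algebra -/

/-- The constant map `ℝⁿ → X` with value `x`. -/
def constRn (n : ℕ) {X : FrolicherSpace} (x : X) : Hom (Rn n) X :=
  ⟨fun _ => x, fun _ _ => const_mem_curves x⟩

theorem toReal_smooth {X : FrolicherSpace} {f : X → ℝ} (hf : f ∈ X.functions) (c : ℝ → X)
    (hc : c ∈ X.curves) : (f ∘ c : ℝ → R) ∈ R.curves :=
  mem_curves_R.2 (contDiff_comp hf hc)

/-- After applying `χ`, the classes are real multiples of the class of 1, so a linear functional on
them is `χ ∘ c` times a constant. -/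
theorem prol_real_mem_curves {X : FrolicherSpace} {c : ℝ → X} (hc : c ∈ X.curves) :
    (fun t => cls WeilAlgebra.real (constRn _ (c t))) ∈ (prol X WeilAlgebra.real).curves := by
  rintro _ ⟨χ, v, hv, rfl⟩
  refine contDiff_comp hv (c := fun t => prolSetMap χ WeilAlgebra.real
    (cls WeilAlgebra.real (constRn _ (c t)))) ?_
  rintro w ⟨l, -, hw⟩
  have h : ∀ t, w (prolSetMap χ WeilAlgebra.real (cls WeilAlgebra.real (constRn _ (c t)))) =
      toReal (χ (c t)) * l 1 := by
    intro t
    have h1 := hw (toReal (χ (c t)) • (1 : Cinf 0))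
    have h2 : l (toReal (χ (c t)) • 1) = toReal (χ (c t)) * l 1 := map_smul l _ 1
    refine Eq.trans ?_ (h1.trans h2)
    refine congrArg w (congrArg (Quotient.mk _) (Hom.ext (funext fun x => ?_)))
    exact (mul_one (toReal (χ (c t)))).symm
  exact (congrArg (ContDiff ℝ ∞) (funext h)).mpr
    ((mem_curves_R.1 (χ.smooth c hc)).mul contDiff_const)

/-- The isomorphism `X = X ⊗ ℝ`. -/
def prolReal (X : FrolicherSpace) : Diffeo X (prol X WeilAlgebra.real) where
  hom := ⟨fun x => cls WeilAlgebra.real (constRn _ x), fun _ hc => prol_real_mem_curves hc⟩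
  inv :=
    { toFun := Quotient.lift (fun f : Hom (Rn WeilAlgebra.real.dim) X => f fun _ => (0 : ℝ))
        fun _ _ h => h.1
      smooth := fun c hc => (X.mem_curves_iff _).2 fun φ hφ => by
        let v : ProlSet R WeilAlgebra.real → ℝ := Quotient.lift
          (fun f : Hom (Rn WeilAlgebra.real.dim) R => toReal (f fun _ => (0 : ℝ)))
          fun _ _ h => congrArg toReal h.1
        -- Evaluation at the origin is a linear functional that kills the ideal.
        have hv : v ∈ (realProl WeilAlgebra.real).functions := fun d hd => hd v
          ⟨{ toFun := fun u => u.1 0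
             map_add' := fun _ _ => rfl
             map_smul' := fun _ _ => rfl }, fun u hu => WeilAlgebra.real.le_maxIdeal hu,
            fun u => rfl⟩
        have h := hc _ ⟨⟨φ, fun d hd => toReal_smooth hφ d hd⟩, v, hv, rfl⟩
        convert! h using 1
        funext t
        refine Quotient.inductionOn (motive := fun q => φ (Quotient.lift
          (fun f : Hom (Rn WeilAlgebra.real.dim) X => f fun _ => (0 : ℝ)) _ q) =
            v (prolSetMap ⟨φ, fun d hd => toReal_smooth hφ d hd⟩ WeilAlgebra.real q)) (c t) ?_
        intro f
        rfl }
  left_inv x := rfl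
  right_inv q := by
    obtain ⟨f, rfl⟩ := exists_cls q
    refine congrArg (cls WeilAlgebra.real) (Hom.ext (funext fun x => ?_))
    exact congrArg f.toFun (funext fun i => i.elim0)

/-! ### Curves in `ℝᵃ⁺ᵇ` -/

/-- The pairing of two curves in `ℝᵃ` and in `ℝᵇ` as a curve in `ℝᵃ⁺ᵇ`. -/
theorem append_mem_curves {a b : ℕ} {c : ℝ → Rn a} {d : ℝ → Rn b} (hc : c ∈ (Rn a).curves)
    (hd : d ∈ (Rn b).curves) :
    (fun t => (Fin.append (α := ℝ) (c t) (d t) : Rn (a + b))) ∈ (Rn (a + b)).curves :=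
  mem_curves_Rn.2 fun i => by
    refine Fin.addCases (fun j => ?_) (fun j => ?_) i
    · exact (congrArg (ContDiff ℝ ∞) (funext fun t =>
        Fin.append_left (α := ℝ) (c t) (d t) j)).mpr (mem_curves_Rn.1 hc j)
    · exact (congrArg (ContDiff ℝ ∞) (funext fun t =>
        Fin.append_right (α := ℝ) (c t) (d t) j)).mpr (mem_curves_Rn.1 hd j)

/-- The first `a` coordinates of a point of `ℝᵃ⁺ᵇ`. -/
def head {a b : ℕ} (z : Rn (a + b)) : Rn a := substRn (Fin.castAdd b) z

/-- The last `b` coordinates of a point of `ℝᵃ⁺ᵇ`. -/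
def tail {a b : ℕ} (z : Rn (a + b)) : Rn b := substRn (Fin.natAdd a) z

theorem head_mem_curves {a b : ℕ} {c : ℝ → Rn (a + b)} (hc : c ∈ (Rn (a + b)).curves) :
    (fun t => head (c t)) ∈ (Rn a).curves :=
  (substRn (Fin.castAdd b)).smooth c hc

theorem tail_mem_curves {a b : ℕ} {c : ℝ → Rn (a + b)} (hc : c ∈ (Rn (a + b)).curves) :
    (fun t => tail (c t)) ∈ (Rn b).curves :=
  (substRn (Fin.natAdd a)).smooth c hc

/-- The point of `ℝᵃ⁺ᵇ` with the given coordinates. -/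
def append {a b : ℕ} (x : Rn a) (y : Rn b) : Rn (a + b) := Fin.append (α := ℝ) x y

theorem head_append {a b : ℕ} (x : Rn a) (y : Rn b) : head (append x y) = x :=
  funext fun i => Fin.append_left (α := ℝ) x y i

theorem tail_append {a b : ℕ} (x : Rn a) (y : Rn b) : tail (append x y) = y :=
  funext fun i => Fin.append_right (α := ℝ) x y i

theorem append_head_tail {a b : ℕ} (z : Rn (a + b)) : append (head z) (tail z) = z := by
  funext i
  refine Fin.addCases (fun i => ?_) (fun i => ?_) i
  · exact Fin.append_left (α := ℝ) (head z) (tail z) i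
  · exact Fin.append_right (α := ℝ) (head z) (tail z) i

theorem substRn_assocFin_append {a b c : ℕ} (x : Rn a) (y : Rn (b + c)) :
    substRn (assocFin a b c) (append x y) = append (append x (head y)) (tail y) := by
  suffices h : ∀ (x : Fin a → ℝ) (y : Fin (b + c) → ℝ) (i : Fin (a + b + c)),
      Fin.append x y (assocFin a b c i) = Fin.append
        (Fin.append x fun i => y (Fin.castAdd c i)) (fun i => y (Fin.natAdd b i)) i from
    funext fun i => h x y i
  intro x y i
  refine Fin.addCases (fun i => ?_) (fun i => ?_) i
  · refine Fin.addCases (fun i => ?_) (fun i => ?_) i <;> simp [assocFin]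
  · simp [assocFin]

/-- The partial map `g(·, x₂)` of a smooth map `g` on `ℝᵃ⁺ᵇ`. -/
def sliceRn {a b : ℕ} {X : FrolicherSpace} (g : Hom (Rn (a + b)) X) (x₂ : Rn b) : Hom (Rn a) X :=
  ⟨fun x₁ => g (append x₁ x₂), fun _ hc =>
    g.smooth _ (append_mem_curves hc (const_mem_curves x₂))⟩

/-! ### Consequences of Weil-exponentiability -/

namespace IsWeilExponentiable

variable {X : FrolicherSpace}

theorem exists_diffeo (hX : IsWeilExponentiable X) (Y : FrolicherSpace) (W₁ W₂ : WeilAlgebra) :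
    ∃ Φ : Diffeo (prol (mapSpace Y (prol X W₁)) W₂) (mapSpace Y (prol X (W₁.tensor W₂))),
      ∀ (g : Hom (prod (Rn (W₁.dim + W₂.dim)) Y) X)
        (h : Hom (Rn W₂.dim) (mapSpace Y (prol X W₁))),
        (∀ x₂ y, ev (h x₂) y = cls W₁ (slice g x₂ y)) →
        ∀ y, ev (Φ.hom (cls W₂ h)) y = cls (W₁.tensor W₂) (sliceLeft g y) := by
  obtain ⟨Φ, hΦ⟩ := hX Y W₁ W₂
  exact ⟨Diffeo.ofIso Φ, hΦ⟩

/-- The isomorphism `X^Y ⊗ W = (X ⊗ W)^Y`. -/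
theorem exists_prol_mapSpace (hX : IsWeilExponentiable X) (Y : FrolicherSpace) (W : WeilAlgebra) :
    ∃ α : Diffeo (prol (mapSpace Y X) W) (mapSpace Y (prol X W)),
      ∀ (h : Hom (Rn W.dim) (mapSpace Y X)) (y : Y),
        ev (α.hom (cls W h)) y = cls W (evalAt h y) := by
  -- Taking `W₁ = ℝ` makes the inner prolongation trivial on both sides.
  obtain ⟨Φ, hΦ⟩ := exists_diffeo hX Y WeilAlgebra.real W
  refine ⟨(((prolReal X).mapSpace Y).prol W).trans (Φ.trans ((leftUnitor X W).mapSpace Y)),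
    fun h y => ?_⟩
  have key := hΦ ⟨fun q => ev (h (tail q.1)) q.2, fun c hc =>
      mem_curves_of_hom h (tail_mem_curves (mem_curves_prod.1 hc).1) (mem_curves_prod.1 hc).2⟩
    (((prolReal X).mapSpace Y).hom.comp h) (fun x₂ y => by
      refine congrArg (cls WeilAlgebra.real) (Hom.ext (funext fun x₁ => ?_))
      exact congrArg (fun x => ev (h x) y) (tail_append (a := 0) x₁ x₂).symm) y
  refine (congrArg (leftUnitor X W).hom.toFun key).trans ?_
  refine congrArg (cls W) (Hom.ext (funext fun x => ?_))
  refine congrArg (fun x => ev (h x) y) (funext fun i => ?_)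
  exact congrArg x (Fin.addCases_right (m := 0) i)

/-- A smooth map `Y → X ⊗ W` is given by a smooth map `ℝᵏ × Y → X`. -/
theorem exists_lift (hX : IsWeilExponentiable X) {Y : FrolicherSpace} {W : WeilAlgebra}
    (k : Hom Y (prol X W)) :
    ∃ h : Hom (Rn W.dim) (mapSpace Y X), ∀ y, k y = cls W (evalAt h y) := by
  obtain ⟨α, hα⟩ := exists_prol_mapSpace hX Y W
  -- A representative of the preimage in `X^Y ⊗ W` chooses representatives of all `k y` at once,
  -- smoothly in `y`.
  obtain ⟨h, hh⟩ := exists_cls (α.inv k)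
  refine ⟨h, fun y => ?_⟩
  rw [← hα, hh]
  exact congrArg (fun k => ev k y) (α.right_inv k).symm

/-- The isomorphism `(X ⊗ W₁) ⊗ W₂ = X ⊗ (W₁ ⊗_∞ W₂)`. -/
theorem exists_prol_prol (hX : IsWeilExponentiable X) (W₁ W₂ : WeilAlgebra) :
    ∃ β : Diffeo (prol (prol X W₁) W₂) (prol X (W₁.tensor W₂)),
      ∀ (g : Hom (Rn (W₁.dim + W₂.dim)) X) (h : Hom (Rn W₂.dim) (prol X W₁)),
        (∀ x₂, h x₂ = cls W₁ (sliceRn g x₂)) → β.hom (cls W₂ h) = cls (W₁.tensor W₂) g := by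
  -- For `Y` a point the exponentials disappear.
  obtain ⟨Φ, hΦ⟩ := exists_diffeo hX point W₁ W₂
  refine ⟨((pointDiffeo (prol X W₁)).prol W₂).trans (Φ.trans (pointDiffeo _).symm),
    fun g h hgh => ?_⟩
  exact hΦ (g.comp ⟨fun q => q.1, fun c hc => (mem_curves_prod.1 hc).1⟩)
    ((pointDiffeo (prol X W₁)).hom.comp h) (fun x₂ _ => hgh x₂) PUnit.unit

/-- `X ⊗ W` is Weil-exponentiable. -/
theorem prol (hX : IsWeilExponentiable X) (W : WeilAlgebra) :
    IsWeilExponentiable (X.prol W) := by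
  intro Y W₁ W₂
  obtain ⟨β₁, h₁⟩ := exists_prol_prol hX W W₁
  obtain ⟨β₂, h₂⟩ := exists_prol_prol hX W (W₁.tensor W₂)
  obtain ⟨Φ, hΦ⟩ := exists_diffeo hX Y (W.tensor W₁) W₂
  refine ⟨(((β₁.mapSpace Y).prol W₂).trans (Φ.trans (((associator X W W₁ W₂).mapSpace Y).trans
    (β₂.symm.mapSpace Y)))).toIso, fun g h hgh y => ?_⟩
  -- To verify that the composite is canonical, `g`, which takes values in `X ⊗ W`, is lifted to a
  -- smooth map into `X`. The canonical identifications `β₁`, `Φ`, `β₂` can then all be evaluated on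
  -- classes of its partial maps.
  obtain ⟨H, hH⟩ := exists_lift hX g
  let G : Hom (prod (Rn (W.dim + W₁.dim + W₂.dim)) Y) X :=
    ⟨fun q => ev (H (head (head q.1))) ((append (tail (head q.1)) (tail q.1), q.2)), fun c hc => by
      have hc1 := (mem_curves_prod.1 hc).1
      exact mem_curves_of_hom H (head_mem_curves (head_mem_curves hc1))
        (mem_curves_prod.2 ⟨append_mem_curves (tail_mem_curves (head_mem_curves hc1))
          (tail_mem_curves hc1), (mem_curves_prod.1 hc).2⟩)⟩
  have hG : ∀ x x₁ x₂ y, G (append (append x x₁) x₂, y) = ev (H x) (append x₁ x₂, y) := by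
    intro x x₁ x₂ y
    change ev (H (head (head (append (append x x₁) x₂)))) (append (tail (head
      (append (append x x₁) x₂))) (tail (append (append x x₁) x₂)), y) = _
    rw [head_append, head_append, tail_append, tail_append]
  have key := hΦ G ((β₁.mapSpace Y).hom.comp h) (fun x₂ y => by
    refine (congrArg β₁.hom.toFun (hgh x₂ y)).trans (h₁ (slice G x₂ y) _ fun x₁ => ?_)
    refine (hH _).trans (congrArg (cls W) (Hom.ext (funext fun x => ?_)))
    exact (hG x x₁ x₂ y).symm) y
  let G' : Hom (Rn (W.dim + (W₁.dim + W₂.dim))) X :=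
    (sliceLeft G y).comp (substRn (assocFin W.dim W₁.dim W₂.dim))
  have hG' : β₂.hom (cls (W₁.tensor W₂) (sliceLeft g y)) = cls (W.tensor (W₁.tensor W₂)) G' := by
    refine h₂ G' _ fun x₁ => ?_
    refine (hH _).trans (congrArg (cls W) (Hom.ext (funext fun x => ?_)))
    change ev (H x) (x₁, y) = G (substRn (assocFin W.dim W₁.dim W₂.dim) (append x x₁), y)
    rw [substRn_assocFin_append x x₁, hG, append_head_tail x₁]
  refine (congrArg (fun q => β₂.inv ((associator X W W₁ W₂).hom q)) key).trans ?_
  exact (congrArg β₂.inv.toFun hG'.symm).trans (β₂.left_inv _)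

/-- `X^Z` is Weil-exponentiable. -/
theorem mapSpace (hX : IsWeilExponentiable X) (Z : FrolicherSpace) :
    IsWeilExponentiable (Z.mapSpace X) := by
  intro Y W₁ W₂
  obtain ⟨α₁, h₁⟩ := exists_prol_mapSpace hX Z W₁
  obtain ⟨α₂, h₂⟩ := exists_prol_mapSpace hX Z (W₁.tensor W₂)
  -- The exponent `Z` is absorbed into `Y` via `(X^Z)^Y = X^(Z × Y)`.
  obtain ⟨Φ, hΦ⟩ := exists_diffeo hX (prod Z Y) W₁ W₂
  refine ⟨((((α₁.mapSpace Y).trans (curryDiffeo Z Y _).symm).prol W₂).trans (Φ.trans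
    ((curryDiffeo Z Y _).trans (α₂.symm.mapSpace Y)))).toIso, fun g h hgh y => ?_⟩
  let G : Hom (prod (Rn (W₁.dim + W₂.dim)) (prod Z Y)) X :=
    ⟨fun q => ev (g (q.1, q.2.2)) q.2.1, fun c hc => by
      have h1 := mem_curves_prod.1 hc
      have h2 := mem_curves_prod.1 h1.2
      exact mem_curves_of_hom g (mem_curves_prod.2 ⟨h1.1, h2.2⟩) h2.1⟩
  have key := hΦ G (((α₁.mapSpace Y).trans (curryDiffeo Z Y _).symm).hom.comp h) (fun x₂ q =>
    (congrArg (fun k => ev (α₁.hom k) q.1) (hgh x₂ q.2)).trans (h₁ _ _))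
  -- After applying `α₂` both sides are maps on `Z` and can be compared pointwise.
  have e : α₂.hom (cls (W₁.tensor W₂) (sliceLeft g y)) =
      (ev ((curryDiffeo Z Y _).hom (Φ.hom (cls W₂
        (((α₁.mapSpace Y).trans (curryDiffeo Z Y _).symm).hom.comp h)))) y) :=
    mapSpace_ext fun z => (h₂ _ z).trans (key (z, y)).symm
  exact (congrArg α₂.inv.toFun e.symm).trans (α₂.left_inv _)

end IsWeilExponentiable

end FrolicherSpace

/-! ### Exponentiation by a representable functor -/

section Exponential

variable {𝒞 : Type} [SmallCategory 𝒞]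

/-- If `C` has coproducts `P C'` with all objects `C'`, then the exponential of `G` by the functor
represented by `C` is isomorphic to every functor `G'` with natural bijections
`G (P C') ≃ G' C'`. -/
theorem nonempty_functorHom_iso (C : 𝒞) (G G' : 𝒞 ⥤ Type) (P : 𝒞 → 𝒞) (inl : ∀ C', C ⟶ P C')
    (inr : ∀ C', C' ⟶ P C')
    (hdesc : ∀ {C' A : 𝒞} (a : C ⟶ A) (b : C' ⟶ A), ∃ d : P C' ⟶ A, inl C' ≫ d = a ∧ inr C' ≫ d = b)
    (hext : ∀ {C' A : 𝒞} {d d' : P C' ⟶ A}, inl C' ≫ d = inl C' ≫ d' → inr C' ≫ d = inr C' ≫ d' →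
      d = d')
    (θ : ∀ C', G.obj (P C') ≃ G'.obj C')
    (hθ : ∀ {C' C'' : 𝒞} (ψ : C' ⟶ C'') (m : P C' ⟶ P C''), inl C' ≫ m = inl C'' →
      inr C' ≫ m = ψ ≫ inr C'' → ∀ x, θ C'' (G.map m x) = G'.map ψ (θ C' x)) :
    Nonempty ((coyoneda.obj (Opposite.op C)).functorHom G ≅ G') := by
  choose desc hl hr using @hdesc
  -- The Yoneda argument: every pair `(a, b)` is the image of the universal pair `(inl, inr)`, so
  -- naturality determines `ξ` from its value there.
  have hξ : ∀ {C' A : 𝒞} (ξ : ((coyoneda.obj (Opposite.op C)).functorHom G).obj C') (a : C ⟶ A)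
      (b : C' ⟶ A), ξ.app A b a = G.map (desc a b) (ξ.app (P C') (inr C') (inl C')) := by
    intro C' A ξ a b
    have h : ξ.app A (inr C' ≫ desc a b) (inl C' ≫ desc a b) =
        G.map (desc a b) (ξ.app (P C') (inr C') (inl C')) :=
      ConcreteCategory.congr_hom (ξ.naturality (desc a b) (inr C')) (inl C')
    rwa [hl, hr] at h
  let e : ∀ C', ((coyoneda.obj (Opposite.op C)).functorHom G).obj C' → G'.obj C' :=
    fun C' ξ => θ C' (ξ.app (P C') (inr C') (inl C'))
  have he : ∀ C', Function.Bijective (e C') := by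
    refine fun C' => ⟨fun ξ ξ' h => Functor.functorHom_ext fun A b => ?_, fun y => ?_⟩
    · ext a
      have h1 := (θ C').injective h
      exact (hξ ξ a b).trans ((congrArg (G.map (desc a b)) h1).trans (hξ ξ' a b).symm)
    · let ξ : ((coyoneda.obj (Opposite.op C)).functorHom G).obj C' :=
        { app := fun A b => ↾fun a => G.map (desc a b) ((θ C').symm y)
          naturality := fun {A A'} f b => by
            ext a
            change G.map (desc (a ≫ f) (b ≫ f)) ((θ C').symm y) =
              G.map f (G.map (desc a b) ((θ C').symm y))
            have h1 : desc (a ≫ f) (b ≫ f) = desc a b ≫ f := hext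
              (by rw [hl, ← Category.assoc, hl]) (by rw [hr, ← Category.assoc, hr])
            rw [h1]
            exact Functor.map_comp_apply G _ _ _ }
      refine ⟨ξ, ?_⟩
      have h1 : desc (inl C') (inr C') = 𝟙 (P C') := hext
        (by rw [hl, Category.comp_id]) (by rw [hr, Category.comp_id])
      change θ C' (G.map (desc (inl C') (inr C')) ((θ C').symm y)) = y
      rw [h1]
      exact (congrArg (θ C') (Functor.map_id_apply G _ _)).trans ((θ C').apply_symm_apply y)
  refine ⟨NatIso.ofComponents (fun C' => (Equiv.ofBijective (e C') (he C')).toIso) ?_⟩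
  intro C' C'' ψ
  ext ξ
  change θ C'' (ξ.app (P C'') (ψ ≫ inr C'') (inl C'')) =
    G'.map ψ (θ C' (ξ.app (P C') (inr C') (inl C')))
  rw [← hθ ψ (desc (inl C'') (ψ ≫ inr C'')) (hl _ _) (hr _ _)]
  exact congrArg (θ C'') (hξ ξ _ _)

end Exponential

/-! ### Morphisms of presented `C^∞`-rings -/

/-- The morphism `C^∞(ℝⁿ)/I → C^∞(ℝᵐ)/J`, `[u] ↦ [u ∘ p]`. -/
def Pres.homOfMap {P Q : Pres} (p : Fin P.dim → Cinf Q.dim)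
    (h : ∀ u ∈ P.ideal, u.comp p ∈ Q.ideal) : P.ring ⟶ Q.ring where
  toFun := Ideal.quotientMap Q.ideal (Cinf.compHom p) h
  map_op {n} f a := by
    obtain ⟨u, rfl⟩ : ∃ u : Fin n → Cinf P.dim, (fun i => Ideal.Quotient.mk P.ideal (u i)) = a :=
      ⟨fun i => (a i).out, funext fun i => Quotient.out_eq' (a i)⟩
    exact (congrArg (Ideal.quotientMap Q.ideal (Cinf.compHom p) h) (P.ring_op_mk f u)).trans
      (Q.ring_op_mk f fun i => (u i).comp p).symm

namespace D

/-- The class in `C^∞(ℝⁿ) ⊗_∞ W` of a smooth function on `ℝⁿ⁺ᵏ`. -/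
def mk (C : D) (u : Cinf (C.n + C.W.dim)) : (DObj.ring C).carrier :=
  Ideal.Quotient.mk (DObj.pres C).ideal u

/-- The class of `u` is the operation `u` applied to the classes of the coordinates, and a
homomorphism commutes with operations. -/
theorem represents_iff {C C' : D} {ψ : C ⟶ C'} {p : Fin (C.n + C.W.dim) → Cinf (C'.n + C'.W.dim)} :
    Represents ψ p ↔ ∀ i, ψ.hom.toFun (mk C (Cinf.coord i)) = mk C' (p i) := by
  refine ⟨fun h i => h (Cinf.coord i), fun h u => ?_⟩
  have h1 := ψ.hom.map_op u fun i => mk C (Cinf.coord i)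
  rw [funext h] at h1
  exact (congrArg ψ.hom.toFun ((DObj.pres C).ring_op_mk u Cinf.coord)).symm.trans
    (h1.trans ((DObj.pres C').ring_op_mk u p))

theorem exists_represents {C C' : D} (ψ : C ⟶ C') : ∃ p, Represents ψ p :=
  ⟨fun i => (ψ.hom.toFun (mk C (Cinf.coord i)) : Cinf _ ⧸ _).out, represents_iff.2 fun i =>
    (Quotient.out_eq' (ψ.hom.toFun (mk C (Cinf.coord i)) : Cinf _ ⧸ _)).symm⟩

theorem hom_eq_of_represents {C C' : D} {ψ ψ' : C ⟶ C'}
    {p : Fin (C.n + C.W.dim) → Cinf (C'.n + C'.W.dim)} (h : Represents ψ p)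
    (h' : Represents ψ' p) : ψ = ψ' := by
  have e : ψ.hom = ψ'.hom := by
    refine CInfRing.Hom.ext (funext fun x => ?_)
    obtain ⟨u, rfl⟩ := Ideal.Quotient.mk_surjective (I := (DObj.pres C).ideal) x
    exact (h u).trans (h' u).symm
  exact InducedCategory.hom_ext e

end D

/-- Since `u` and 0 have the same class, so do their composites with `p`. -/
theorem Represents.comp_mem {C C' : D} {ψ : C ⟶ C'}
    {p : Fin (C.n + C.W.dim) → Cinf (C'.n + C'.W.dim)} (h : Represents ψ p)
    {u : Cinf (C.n + C.W.dim)} (hu : u ∈ (DObj.pres C).ideal) :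
    u.comp p ∈ (DObj.pres C').ideal := by
  have h1 : Ideal.Quotient.mk (DObj.pres C).ideal u = Ideal.Quotient.mk (DObj.pres C).ideal 0 := by
    rw [map_zero]
    exact Ideal.Quotient.eq_zero_iff_mem.2 hu
  have h2 : Ideal.Quotient.mk (DObj.pres C').ideal (u.comp p) =
      Ideal.Quotient.mk (DObj.pres C').ideal 0 :=
    (h u).symm.trans ((congrArg ψ.hom.toFun h1).trans (h 0))
  have h3 : ∀ (P : Pres) (w : Cinf P.dim),
      Ideal.Quotient.mk P.ideal w = Ideal.Quotient.mk P.ideal 0 → w ∈ P.ideal := fun P w hw => by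
    rw [map_zero] at hw
    exact Ideal.Quotient.eq_zero_iff_mem.1 hw
  exact h3 _ _ h2

theorem Represents.comp {C C' C'' : D} {ψ : C ⟶ C'} {ψ' : C' ⟶ C''}
    {p : Fin (C.n + C.W.dim) → Cinf (C'.n + C'.W.dim)}
    {p' : Fin (C'.n + C'.W.dim) → Cinf (C''.n + C''.W.dim)} (h : Represents ψ p)
    (h' : Represents ψ' p') : Represents (ψ ≫ ψ') fun i => (p i).comp p' :=
  D.represents_iff.2 fun i => (congrArg ψ'.hom.toFun (h (Cinf.coord i))).trans (h' (p i))

namespace D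

/-- The factor `C^∞(ℝⁿ)` is free, so only the relations of the Weil algebra impose a condition on
`p`. -/
theorem exists_hom_represents {C C' : D} (p : Fin (C.n + C.W.dim) → Cinf (C'.n + C'.W.dim))
    (h : ∀ u ∈ C.W.ideal, u.comp (fun i => p (Fin.natAdd C.n i)) ∈ (DObj.pres C').ideal) :
    ∃ ψ : C ⟶ C', Represents ψ p :=
  ⟨InducedCategory.homMk (Pres.homOfMap (P := DObj.pres C) (Q := DObj.pres C') p fun _ hu =>
    Pres.comp_mem_of_mem_tensor (P := Pres.free C.n) (Q := C.W.toPres) (fun v hv => by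
      rw [show v = 0 from hv]
      exact (DObj.pres C').ideal.zero_mem) h hu), fun _ => rfl⟩

/-! ### Coproducts in `D` -/

/-- The coproduct of two objects of `D`. -/
def coprod (C C' : D) : D := D.of (C.n + C'.n) (C.W.tensor C'.W)

/-- The components of the projection `ℝ⁽ⁿ⁺ⁿ'⁾⁺⁽ᵏ⁺ᵏ'⁾ → ℝⁿ⁺ᵏ`. -/
def inlMap (n n' k k' : ℕ) : Fin (n + k) → Cinf (n + n' + (k + k')) :=
  Fin.addCases (fun i => Cinf.coord (Fin.castAdd (k + k') (Fin.castAdd n' i)))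
    fun i => Cinf.coord (Fin.natAdd (n + n') (Fin.castAdd k' i))

/-- The components of the projection `ℝ⁽ⁿ⁺ⁿ'⁾⁺⁽ᵏ⁺ᵏ'⁾ → ℝⁿ'⁺ᵏ'`. -/
def inrMap (n n' k k' : ℕ) : Fin (n' + k') → Cinf (n + n' + (k + k')) :=
  Fin.addCases (fun i => Cinf.coord (Fin.castAdd (k + k') (Fin.natAdd n i)))
    fun i => Cinf.coord (Fin.natAdd (n + n') (Fin.natAdd k i))

/-- The components of the map to `ℝ⁽ⁿ⁺ⁿ'⁾⁺⁽ᵏ⁺ᵏ'⁾` given by a map to `ℝⁿ⁺ᵏ` and one to `ℝⁿ'⁺ᵏ'`. -/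
def descMap {n n' k k' m : ℕ} (p : Fin (n + k) → Cinf m) (q : Fin (n' + k') → Cinf m) :
    Fin (n + n' + (k + k')) → Cinf m :=
  Fin.addCases
    (Fin.addCases (fun i => p (Fin.castAdd k i)) fun i => q (Fin.castAdd k' i))
    (Fin.addCases (fun i => p (Fin.natAdd n i)) fun i => q (Fin.natAdd n' i))

theorem inlMap_comp_descMap {n n' k k' m : ℕ} (p : Fin (n + k) → Cinf m)
    (q : Fin (n' + k') → Cinf m) : (fun i => (inlMap n n' k k' i).comp (descMap p q)) = p := by
  funext i
  refine Fin.addCases (fun i => ?_) (fun i => ?_) i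
  · simp only [inlMap, Fin.addCases_left]
    change descMap p q (Fin.castAdd (k + k') (Fin.castAdd n' i)) = _
    simp [descMap]
  · simp only [inlMap, Fin.addCases_right]
    change descMap p q (Fin.natAdd (n + n') (Fin.castAdd k' i)) = _
    simp [descMap]

theorem inrMap_comp_descMap {n n' k k' m : ℕ} (p : Fin (n + k) → Cinf m)
    (q : Fin (n' + k') → Cinf m) : (fun i => (inrMap n n' k k' i).comp (descMap p q)) = q := by
  funext i
  refine Fin.addCases (fun i => ?_) (fun i => ?_) i
  · simp only [inrMap, Fin.addCases_left]
    change descMap p q (Fin.castAdd (k + k') (Fin.natAdd n i)) = _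
    simp [descMap]
  · simp only [inrMap, Fin.addCases_right]
    change descMap p q (Fin.natAdd (n + n') (Fin.natAdd k i)) = _
    simp [descMap]

theorem descMap_natAdd_castAdd {n n' k k' m : ℕ} (p : Fin (n + k) → Cinf m)
    (q : Fin (n' + k') → Cinf m) : (fun i => descMap p q (Fin.natAdd (n + n') (Fin.castAdd k' i))) =
      fun i => p (Fin.natAdd n i) := by
  funext i
  simp [descMap]

theorem descMap_natAdd_natAdd {n n' k k' m : ℕ} (p : Fin (n + k) → Cinf m)
    (q : Fin (n' + k') → Cinf m) : (fun i => descMap p q (Fin.natAdd (n + n') (Fin.natAdd k i))) =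
      fun i => q (Fin.natAdd n' i) := by
  funext i
  simp [descMap]

theorem exists_inl (C C' : D) :
    ∃ ψ : C ⟶ coprod C C', Represents ψ (inlMap C.n C'.n C.W.dim C'.W.dim) :=
  exists_hom_represents (C := C) (C' := coprod C C') _ fun u hu => by
    simp only [inlMap, Fin.addCases_right]
    exact Pres.comp_sndMap_mem (P := Pres.free (C.n + C'.n)) (Q := (C.W.tensor C'.W).toPres)
      (Pres.comp_fstMap_mem (P := C.W.toPres) (Q := C'.W.toPres) hu)

theorem exists_inr (C C' : D) :
    ∃ ψ : C' ⟶ coprod C C', Represents ψ (inrMap C.n C'.n C.W.dim C'.W.dim) :=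
  exists_hom_represents (C := C') (C' := coprod C C') _ fun u hu => by
    simp only [inrMap, Fin.addCases_right]
    exact Pres.comp_sndMap_mem (P := Pres.free (C.n + C'.n)) (Q := (C.W.tensor C'.W).toPres)
      (Pres.comp_sndMap_mem (P := C.W.toPres) (Q := C'.W.toPres) hu)

/-- The coproduct inclusion. -/
def inl (C C' : D) : C ⟶ coprod C C' := (exists_inl C C').choose

theorem represents_inl (C C' : D) :
    Represents (inl C C') (inlMap C.n C'.n C.W.dim C'.W.dim) := (exists_inl C C').choose_spec

/-- The coproduct inclusion. -/
def inr (C C' : D) : C' ⟶ coprod C C' := (exists_inr C C').choose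

theorem represents_inr (C C' : D) :
    Represents (inr C C') (inrMap C.n C'.n C.W.dim C'.W.dim) := (exists_inr C C').choose_spec

/-- Every coordinate of the coproduct comes from one of the summands. This gives uniqueness in the
universal property and an explicit representative for each map out of the coproduct. -/
theorem represents_descMap {C C' A : D} {d : coprod C C' ⟶ A}
    {p : Fin (C.n + C.W.dim) → Cinf (A.n + A.W.dim)}
    {q : Fin (C'.n + C'.W.dim) → Cinf (A.n + A.W.dim)} (hp : Represents (inl C C' ≫ d) p)
    (hq : Represents (inr C C' ≫ d) q) : Represents d (descMap p q) := by
  have hl : ∀ i, d.hom.toFun (mk (coprod C C') (inlMap C.n C'.n C.W.dim C'.W.dim i)) =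
      mk A (p i) := fun i =>
    (congrArg d.hom.toFun (represents_inl C C' (Cinf.coord i))).symm.trans (hp (Cinf.coord i))
  have hr : ∀ i, d.hom.toFun (mk (coprod C C') (inrMap C.n C'.n C.W.dim C'.W.dim i)) =
      mk A (q i) := fun i =>
    (congrArg d.hom.toFun (represents_inr C C' (Cinf.coord i))).symm.trans (hq (Cinf.coord i))
  refine represents_iff.2 fun (i : Fin (C.n + C'.n + (C.W.dim + C'.W.dim))) => ?_
  refine Fin.addCases (fun i => ?_) (fun i => ?_) i
  · refine Fin.addCases (fun i => ?_) (fun i => ?_) i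
    · have := hl (Fin.castAdd _ i)
      simp only [inlMap, Fin.addCases_left] at this
      simp only [descMap, Fin.addCases_left]
      exact this
    · have := hr (Fin.castAdd _ i)
      simp only [inrMap, Fin.addCases_left] at this
      simp only [descMap, Fin.addCases_left, Fin.addCases_right]
      exact this
  · refine Fin.addCases (fun i => ?_) (fun i => ?_) i
    · have := hl (Fin.natAdd _ i)
      simp only [inlMap, Fin.addCases_right] at this
      simp only [descMap, Fin.addCases_left, Fin.addCases_right]
      exact this
    · have := hr (Fin.natAdd _ i)
      simp only [inrMap, Fin.addCases_right] at this
      simp only [descMap, Fin.addCases_right]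
      exact this

theorem exists_desc {C C' A : D} (a : C ⟶ A) (b : C' ⟶ A) :
    ∃ d : coprod C C' ⟶ A, inl C C' ≫ d = a ∧ inr C C' ≫ d = b := by
  obtain ⟨p, hp⟩ := exists_represents a
  obtain ⟨q, hq⟩ := exists_represents b
  obtain ⟨d, hd⟩ := exists_hom_represents (C := coprod C C') (C' := A) (descMap p q) fun u hu =>
    Pres.comp_mem_of_mem_tensor (P := C.W.toPres) (Q := C'.W.toPres)
      (fun v hv => (congrArg (fun r => v.comp r ∈ (DObj.pres A).ideal)
        (descMap_natAdd_castAdd p q)).mpr (hp.comp_mem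
          (Pres.comp_sndMap_mem (P := Pres.free C.n) (Q := C.W.toPres) hv)))
      (fun v hv => (congrArg (fun r => v.comp r ∈ (DObj.pres A).ideal)
        (descMap_natAdd_natAdd p q)).mpr (hq.comp_mem
          (Pres.comp_sndMap_mem (P := Pres.free C'.n) (Q := C'.W.toPres) hv))) hu
  refine ⟨d, hom_eq_of_represents ?_ hp, hom_eq_of_represents ?_ hq⟩
  · exact (congrArg (Represents _) (inlMap_comp_descMap p q)).mp ((represents_inl C C').comp hd)
  · exact (congrArg (Represents _) (inrMap_comp_descMap p q)).mp ((represents_inr C C').comp hd)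

theorem coprod_hom_ext {C C' A : D} {d d' : coprod C C' ⟶ A} (hl : inl C C' ≫ d = inl C C' ≫ d')
    (hr : inr C C' ≫ d = inr C C' ≫ d') : d = d' := by
  obtain ⟨p, hp⟩ := exists_represents (inl C C' ≫ d)
  obtain ⟨q, hq⟩ := exists_represents (inr C C' ≫ d)
  exact hom_eq_of_represents (represents_descMap hp hq)
    (represents_descMap (hl ▸ hp) (hr ▸ hq))

end D

namespace FrolicherSpace

/-! ### The iterated extension `(X ⊗ C) ⊗ C'` -/

/-- The isomorphism `(X^(ℝᵃ))^(ℝᵇ) = X^(ℝᵃ⁺ᵇ)`. -/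
def appendDiffeo (a b : ℕ) (X : FrolicherSpace) :
    Diffeo (mapSpace (Rn b) (mapSpace (Rn a) X)) (mapSpace (Rn (a + b)) X) where
  hom := curry (fun k z => ev (ev k (tail z)) (head z)) fun _ hc _ hη =>
    ev_mem_curves (ev_mem_curves hc (tail_mem_curves hη)) (head_mem_curves hη)
  inv := curry (fun k => (curry (fun y x => ev k (append x y)) fun _ hc _ hη =>
      Hom.smooth k _ (append_mem_curves hη hc) : Hom (Rn b) (mapSpace (Rn a) X)).toFun)
    fun _ hc _ hη => mem_curves_mapSpace_of fun _ _ hτ hζ =>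
      ev_mem_curves (comp_mem_curves hc hτ) (append_mem_curves hζ (comp_mem_curves hη hτ))
  left_inv k := mapSpace_ext fun y => mapSpace_ext fun x => by
    change ev (ev k (tail (append x y))) (head (append x y)) = _
    rw [head_append, tail_append]
  right_inv k := mapSpace_ext fun z => by
    change ev k (append (head z) (tail z)) = _
    rw [append_head_tail]

/-- The smooth map `f : ℝᵏ' → ((X^(ℝⁿ)) ⊗ W)^(ℝⁿ')` is given by classes of partial maps of the
smooth map `F : ℝᵏ⁺ᵏ' → X^(ℝⁿ⁺ⁿ')`. -/
def IsPartialMap {X : FrolicherSpace} {n n' k' : ℕ} {W : WeilAlgebra}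
    (f : Hom (Rn k') (mapSpace (Rn n') (prol (mapSpace (Rn n) X) W)))
    (F : Hom (Rn (W.dim + k')) (mapSpace (Rn (n + n')) X)) : Prop :=
  ∀ (x₂ : Rn k') (y : Rn n'), ∃ u : Hom (Rn W.dim) (mapSpace (Rn n) X), ev (f x₂) y = cls W u ∧
    ∀ x₁ x, ev (u x₁) x = ev (F (append x₁ x₂)) (append x y)

namespace IsWeilExponentiable

variable {X : FrolicherSpace}

/-- The uncurried `f` is a smooth map from `ℝᵏ' × ℝⁿ'` to `X^(ℝⁿ) ⊗ W`; `exists_lift` applies to it,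
and its variables are then regrouped. -/
theorem exists_isPartialMap (hX : IsWeilExponentiable X) {n n' k' : ℕ} {W : WeilAlgebra}
    (f : Hom (Rn k') (FrolicherSpace.mapSpace (Rn n')
      (FrolicherSpace.prol (FrolicherSpace.mapSpace (Rn n) X) W))) :
    ∃ F : Hom (Rn (W.dim + k')) (FrolicherSpace.mapSpace (Rn (n + n')) X), IsPartialMap f F := by
  obtain ⟨H, hH⟩ := exists_lift (mapSpace hX (Rn n)) (Y := prod (Rn k') (Rn n'))
    (⟨fun q => ev (f q.1) q.2, fun _ hc =>
      mem_curves_of_hom f (mem_curves_prod.1 hc).1 (mem_curves_prod.1 hc).2⟩)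
  refine ⟨curry (fun z w => ev (ev (H (head z)) (tail z, tail w)) (head w)) fun _ hc _ hη =>
    ev_mem_curves (mem_curves_of_hom H (head_mem_curves hc)
      (mem_curves_prod.2 ⟨tail_mem_curves hc, tail_mem_curves hη⟩)) (head_mem_curves hη),
    fun x₂ y => ⟨evalAt H (x₂, y), hH (x₂, y), fun x₁ x => ?_⟩⟩
  change _ = ev (ev (H (head (append x₁ x₂))) (tail (append x₁ x₂), tail (append x y)))
    (head (append x y))
  rw [head_append, head_append, tail_append, tail_append]
  rfl

/-- Weil-exponentiability of `X^(ℝⁿ)` merges the two Weil algebras, its case `W₁ = ℝ` moves the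
exponent `ℝⁿ'` back inside the prolongation, and the Euclidean exponents are then joined. The
formula on representatives is kept for the proof of naturality. -/
theorem exists_ext_diffeo (hX : IsWeilExponentiable X) (n n' : ℕ) (W W' : WeilAlgebra) :
    ∃ τ : Diffeo (FrolicherSpace.prol (FrolicherSpace.mapSpace (Rn n')
        (FrolicherSpace.prol (FrolicherSpace.mapSpace (Rn n) X) W)) W')
      (FrolicherSpace.prol (FrolicherSpace.mapSpace (Rn (n + n')) X) (W.tensor W')),
      ∀ (f : Hom (Rn W'.dim) (FrolicherSpace.mapSpace (Rn n')
          (FrolicherSpace.prol (FrolicherSpace.mapSpace (Rn n) X) W)))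
        (F : Hom (Rn (W.dim + W'.dim)) (FrolicherSpace.mapSpace (Rn (n + n')) X)),
        IsPartialMap f F → τ.hom (cls W' f) = cls (W.tensor W') F := by
  have hZ := mapSpace hX (Rn n)
  obtain ⟨Φ, hΦ⟩ := exists_diffeo hZ (Rn n') W W'
  obtain ⟨α, hα⟩ := exists_prol_mapSpace hZ (Rn n') (W.tensor W')
  refine ⟨Φ.trans (α.symm.trans ((appendDiffeo n n' X).prol _)), fun f F hf => ?_⟩
  let G : Hom (prod (Rn (W.dim + W'.dim)) (Rn n')) (FrolicherSpace.mapSpace (Rn n) X) :=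
    curry (fun q x => ev (F q.1) (append x q.2)) fun _ hc _ hη =>
      mem_curves_of_hom F (mem_curves_prod.1 hc).1 (append_mem_curves hη (mem_curves_prod.1 hc).2)
  let h : Hom (Rn (W.tensor W').dim)
      (FrolicherSpace.mapSpace (Rn n') (FrolicherSpace.mapSpace (Rn n) X)) :=
    (appendDiffeo n n' X).inv.comp F
  have key := hΦ G f fun x₂ y => by
    obtain ⟨u, hu, hux⟩ := hf x₂ y
    rw [hu]
    exact congrArg (cls W) (Hom.ext (funext fun x₁ => mapSpace_ext fun x => hux x₁ x))
  have e : α.hom (cls (W.tensor W') h) = Φ.hom (cls W' f) :=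
    mapSpace_ext fun y => (hα h y).trans (key y).symm
  refine (congrArg (fun q => prolMap (appendDiffeo n n' X).hom (W.tensor W') (α.inv q))
    e.symm).trans ?_
  refine (congrArg _ (α.left_inv _)).trans ?_
  exact congrArg (cls (W.tensor W')) (Hom.ext (funext fun x => (appendDiffeo n n' X).right_inv _))

end IsWeilExponentiable

theorem toMap_mem_curves {a b m : ℕ} (p : Fin (a + b) → Cinf m) {c : ℝ → Rn m}
    (hc : c ∈ (Rn m).curves) :
    (fun t => (Cinf.toMap p (c t) : Rn (a + b))) ∈ (Rn (a + b)).curves :=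
  mem_curves_Rn.2 fun i => (p i).contDiff.comp (contDiff_pi.2 (mem_curves_Rn.1 hc))

/-- Substitution of a smooth map in a smooth map `ℝᵏ → X^(ℝⁿ)`, viewed as a map on `ℝⁿ⁺ᵏ`. -/
theorem exists_uncurry_eq {X : FrolicherSpace} {n k n' k' : ℕ} (p : Fin (n + k) → Cinf (n' + k'))
    (f : Hom (Rn k) (mapSpace (Rn n) X)) :
    ∃ f' : Hom (Rn k') (mapSpace (Rn n') X), ∀ z, uncurry f' z = uncurry f (Cinf.toMap p z) := by
  refine ⟨curry (fun x y => uncurry f (Cinf.toMap p (append y x))) fun _ hc _ hη => ?_, fun z => ?_⟩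
  · have h := toMap_mem_curves p (append_mem_curves hη hc)
    exact mem_curves_of_hom f (tail_mem_curves h) (head_mem_curves h)
  · exact congrArg (fun z => uncurry f (Cinf.toMap p z)) (append_head_tail z)

end FrolicherSpace

/-! ### Naturality of the iterated extension. -/

open FrolicherSpace

/-- Substitution in the variables of `C'` commutes with the inclusion of the variables of `C`. -/
theorem toMap_descMap_append {n n' n'' k k' k'' : ℕ} (p : Fin (n' + k') → Cinf (n'' + k''))
    (x : Rn n) (y : Rn n'') (x₁ : Rn k) (x₂ : Rn k'') :
    (Cinf.toMap (D.descMap (D.inlMap n n'' k k'') fun i => (p i).comp (D.inrMap n n'' k k''))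
      (append (append x y) (append x₁ x₂)) : Rn _) =
      append (append x (head (Cinf.toMap p (append y x₂))))
        (append x₁ (tail (Cinf.toMap p (append y x₂)))) := by
  have hr : Cinf.toMap (D.inrMap n n'' k k'') (append (append x y) (append x₁ x₂)) =
      append y x₂ := by
    suffices h : ∀ (x : Fin n → ℝ) (y : Fin n'' → ℝ) (x₁ : Fin k → ℝ) (x₂ : Fin k'' → ℝ) i,
        (D.inrMap n n'' k k'' i).1 (Fin.append (Fin.append x y) (Fin.append x₁ x₂)) =
          Fin.append y x₂ i from funext fun i => h x y x₁ x₂ i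
    intro x y x₁ x₂ i
    refine Fin.addCases (fun i => ?_) (fun i => ?_) i <;> simp [D.inrMap, Cinf.coord]
  rw [← hr]
  suffices h : ∀ (x : Fin n → ℝ) (y : Fin n'' → ℝ) (x₁ : Fin k → ℝ) (x₂ : Fin k'' → ℝ) i,
      (D.descMap (D.inlMap n n'' k k'') (fun i => (p i).comp (D.inrMap n n'' k k'')) i).1
        (Fin.append (Fin.append x y) (Fin.append x₁ x₂)) =
      Fin.append (Fin.append x fun i => (p (Fin.castAdd k' i)).1 (Cinf.toMap (D.inrMap n n'' k k'')
          (Fin.append (Fin.append x y) (Fin.append x₁ x₂))))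
        (Fin.append x₁ fun i => (p (Fin.natAdd n' i)).1 (Cinf.toMap (D.inrMap n n'' k k'')
          (Fin.append (Fin.append x y) (Fin.append x₁ x₂)))) i from funext fun i => h x y x₁ x₂ i
  intro x y x₁ x₂ i
  refine Fin.addCases (fun i => ?_) (fun i => ?_) i <;>
    refine Fin.addCases (fun i => ?_) (fun i => ?_) i <;>
    simp [D.descMap, D.inlMap, Cinf.coord, Cinf.comp]

namespace ExtFunctoriality

/-- Currying applies the bifunctor to the pair of `𝟙 X` and `ψ`; the factor coming from the identity
is removed here. -/
theorem J_map (E : ExtFunctoriality) (X : FSWE) {C C' : D} (ψ : C ⟶ C') (x : X.obj.ext C) :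
    ((E.J.obj X).map ψ) x = E.map X ψ x := by
  change E.map X ψ ((extMap (Hom.id X.obj) C) x) = _
  rw [extMap_id]
  rfl

/-- The isomorphisms `(X ⊗ C) ⊗ C' = X ⊗ (C ⊗_∞ C')` are natural in `C'`. -/
theorem diffeo_natural (E : ExtFunctoriality) (X : FSWE) (C : D)
    (hX : IsWeilExponentiable (X.obj.ext C))
    (τ : ∀ C' : D, Diffeo ((X.obj.ext C).ext C') (X.obj.ext (D.coprod C C')))
    (hτ : ∀ (C' : D) (f : Hom (Rn C'.W.dim) (mapSpace (Rn C'.n) (X.obj.ext C)))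
      (F : Hom (Rn (C.W.dim + C'.W.dim)) (mapSpace (Rn (C.n + C'.n)) X.obj)),
      IsPartialMap f F → (τ C').hom (cls C'.W f) = cls (C.W.tensor C'.W) F)
    {C' C'' : D} (ψ : C' ⟶ C'') (m : D.coprod C C' ⟶ D.coprod C C'')
    (hl : D.inl C C' ≫ m = D.inl C C'') (hr : D.inr C C' ≫ m = ψ ≫ D.inr C C'')
    (q : (X.obj.ext C).ext C') :
    (τ C'').hom (E.map ⟨X.obj.ext C, hX⟩ ψ q) = E.map X m ((τ C').hom q) := by
  obtain ⟨f, rfl⟩ := exists_cls q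
  obtain ⟨F, hF⟩ := IsWeilExponentiable.exists_isPartialMap X.property f
  obtain ⟨p, hp⟩ := D.exists_represents ψ
  -- The conditions on `m` force a representative: the identity in the variables of `C` and `p` in
  -- those of `C'`.
  have hm := D.represents_descMap (d := m) (hl ▸ D.represents_inl C C'')
    (hr ▸ hp.comp (D.represents_inr C C''))
  obtain ⟨f', hf'⟩ := exists_uncurry_eq p f
  obtain ⟨F', hF'⟩ := exists_uncurry_eq (D.descMap (D.inlMap C.n C''.n C.W.dim C''.W.dim)
    fun i => (p i).comp (D.inrMap C.n C''.n C.W.dim C''.W.dim)) F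
  rw [hτ C' f F hF]
  refine (congrArg (τ C'').hom.toFun (E.map_cls ⟨X.obj.ext C, hX⟩ ψ p hp f f' hf')).trans ?_
  refine Eq.trans ?_ (E.map_cls X m _ hm F F' hF').symm
  refine hτ C'' f' F' fun x₂ y => ?_
  -- The substitution leaves `x` and `x₁` untouched, so the partial map of `F'` at `(x₂, y)` is the
  -- partial map of `F` at the image of `(y, x₂)` under `p`.
  obtain ⟨u, hu, hux⟩ := hF (tail (Cinf.toMap p (append y x₂))) (head (Cinf.toMap p (append y x₂)))
  refine ⟨u, ?_, fun x₁ x => ?_⟩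
  · refine Eq.trans ?_ ((hf' (append y x₂)).trans hu)
    change _ = ev (f' (tail (append y x₂))) (head (append y x₂))
    rw [head_append, tail_append]
    rfl
  · have h1 := hF' (append (append x y) (append x₁ x₂))
    change ev (F' (tail (append (append x y) (append x₁ x₂))))
      (head (append (append x y) (append x₁ x₂))) = uncurry F (Cinf.toMap _ _) at h1
    rw [head_append, tail_append] at h1
    rw [h1, toMap_descMap_append, hux]
    change _ = ev (F (tail (append _ _))) (head (append _ _))
    rw [head_append, tail_append]

end ExtFunctoriality

end Cahiers

end

/-! ### The exponential of `J(X)` by a representable functor. -/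

theorem proposition5p2 (E : ExtFunctoriality) (X : FSWE) (n : ℕ) (W : WeilAlgebra) :
    ∃ hX : FrolicherSpace.IsWeilExponentiable (X.obj.ext (D.of n W)),
      Nonempty ((ihom (coyoneda.obj (Opposite.op (D.of n W)))).obj (E.J.obj X) ≅
        E.J.obj ⟨X.obj.ext (D.of n W), hX⟩) := by
  have hX : FrolicherSpace.IsWeilExponentiable (X.obj.ext (D.of n W)) :=
    (X.property.mapSpace _).prol W
  refine ⟨hX, ?_⟩
  choose τ hτ using fun C' : D => X.property.exists_ext_diffeo n C'.n W C'.W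
  refine nonempty_functorHom_iso (D.of n W) (E.J.obj X) (E.J.obj ⟨X.obj.ext (D.of n W), hX⟩)
    (D.coprod (D.of n W)) (D.inl _) (D.inr _) D.exists_desc D.coprod_hom_ext
    (fun C' => ⟨(τ C').inv.toFun, (τ C').hom.toFun, (τ C').right_inv, (τ C').left_inv⟩)
    fun {C' C''} ψ m hl hr x => ?_
  -- The bijections required start from `X ⊗ (C ⊗_∞ C')` and are thus the inverses of `τ`;
  -- naturality of `τ` at the preimage of `x` yields theirs.
  have h := E.diffeo_natural X (D.of n W) hX τ hτ ψ m hl hr ((τ C').inv x)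
  refine (congrArg (τ C'').inv.toFun (E.J_map X m x)).trans
    (Eq.trans ?_ (E.J_map ⟨_, hX⟩ ψ ((τ C').inv x)).symm)
  refine Eq.trans ?_ ((τ C'').left_inv _)
  exact congrArg (τ C'').inv.toFun
    ((congrArg (E.map X m).toFun ((τ C').right_inv x)).symm.trans h.symm)
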